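/- Words are finite words over the alphabet $\mathbb{Z}_{\ge 0}$. For coprime positive integers $a,b$ and a nonempty word $v=v_0\cdots v_{m-1}$ whose length $m$ is divisible by $b$, put $v^{a/b}=v^{\lfloor a/b\rfloor}v_0v_1\cdots v_{m(a/b-\lfloor a/b\rfloor)-1}$; such a word is called an $\frac ab$-power. A word is $\frac ab$-power-free if none of its (contiguous) factors is an $\frac ab$-power. A morphism assigns to each letter $n$ a word $\varphi(n)$ and is extended to words by concatenation; it is $k$-uniform if $|\varphi(n)|=k$ for all $n$, and $\frac ab$-power-free if $\varphi(w)$ is $\frac ab$-power-free whenever $w$ is. A $k$-uniform morphism $\varphi$ (with $k\ge 2$) locates a word $x$ if there is an integer $j$ such that, for all words $w$, every occurrence of $x$ as a factor of $\varphi(w)$ begins at a position congruent to $j$ modulo $k$; it locates words of length $\ell\ge 1$ if it locates every word $x$ of length $\ell$. For integers $i,j$ and a letter $c$ write $[i,j]_c=0^{ia+jb-1}\,c$, and $[i,j]=[i,j]_1$. Theorem. Consider any of the 30 items below, each of which gives an interval for $\frac ab$, possibly a finite set of excluded values of $\frac ab$, a positive integer $s$ and an integer $t \geq 0$ with $k=sa-tb$,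 a length $\ell$, and a morphism $\varphi$, all depending on $a$ and $b$. Let $a,b$ be coprime positive integers such that $\frac ab$ lies in the stated interval and is not excluded, and such that $\gcd(b,s)=1$. Then all exponents $ia+jb-1$ occurring in $\varphi$ are nonnegative, $\varphi$ is $k$-uniform, $\varphi(n)$ has exactly $N$ nonzero letters for every $n$, where $N$ is the number of bracketed blocks in the displayed expression of $\varphi(n)$, $\varphi$ locates words of length $\ell$, and $\varphi$ is $\frac ab$-power-free. In item 1, moreover, $\varphi$ locates every word of length $2a-2b$ that contains a nonzero letter and, if $a=2b-1$, it locates all words of length $2a-2b$. 1. $\frac{5}{3} \le \frac ab < 2$; $s=2$, $k=2a-b$, $\ell=a$ ($N=2$); $\varphi(n)$ is the word $[1,0][1,-1]_{n+1}$. 2. $\frac{5}{4} < \frac ab < \frac{4}{3}$; $s=1$, $k=a$, $\ell=3a-3b$ ($N=3$); $\varphi(n)$ is the word $[5,-6][-2,3][-2,3]_{n+2}$. 3. $\frac{3}{2} < \frac ab < \frac{5}{3}$; $s=5$, $k=5a-4b$, $\ell=5a-5b$ ($N=4$); $\varphi(n)$ is the word $[1,0][1,-1][2,-2][1,-1]_{n+1}$.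 4. $\frac{6}{5} < \frac ab < \frac{5}{4}$, $\frac ab\notin\{\frac{11}{9},\frac{17}{14}\}$; $s=1$, $k=a$, $\ell=a$ ($N=4$); $\varphi(n)$ is the word $[6,-7][-3,4][-8,10][6,-7]_{n+1}$. 5. $\frac{4}{3} < \frac ab < 2$, $\frac ab\notin\{\frac{5}{3},\frac{7}{5}\}$; $s=4$, $k=4a-2b$, $\ell=5a-4b$ ($N=6$); $\varphi(n)$ is the word $[2,-2][-1,2][3,-4][-1,2][2,-2][-1,2]_{n+1}$. 6. $\frac{4}{3} < \frac ab < 2$, $\frac ab\notin\{\frac{5}{3},\frac{7}{5}\}$; $s=4$, $k=4a-2b$, $\ell=5a-4b$ ($N=6$); $\varphi(n)$ is the word $[-1,2][2,-2][-1,2][2,-2][-1,2][3,-4]_{n+1}$. 7. $\frac{5}{4} < \frac ab < \frac{4}{3}$, $\frac ab\notin\{\frac{9}{7}\}$; $s=5$, $k=5a-3b$, $\ell=6a-6b$ ($N=8$); $\varphi(n)$ is the word $[5,-6][2,-2][1,-1][-2,3][3,-3][-6,8][1,-1][1,-1]_{n+1}$. 8. $\frac{6}{5} < \frac ab < \frac{5}{4}$,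 $\frac ab\notin\{\frac{11}{9},\frac{16}{13},\frac{17}{14},\frac{23}{19}\}$; $s=11$, $k=11a-10b$, $\ell=7a-7b$ ($N=10$); $\varphi(n)$ is the word $[-2,3][3,-3][1,-1][-3,4][5,-6][1,-1][2,-2][1,-1][2,-2][1,-1]_{n+1}$. 9. $\frac{7}{6} < \frac ab < \frac{6}{5}$, $\frac ab\notin\{\frac{13}{11}\}$; $s=7$, $k=7a-5b$, $\ell=5a-3b$ ($N=12$); $\varphi(n)$ is the word $[7,-8][-4,5][6,-7][2,-2][1,-1][-4,5][2,-2][3,-3][-4,5][-4,5][1,-1][1,-1]_{n+1}$. 10. $\frac{6}{5} < \frac ab < \frac{5}{4}$; $s=7$, $k=7a-4b$, $\ell=5a-5b$ ($N=13$); $\varphi(n)$ is the word $[1,-1][-3,4][4,-4][-3,4][5,-6][1,-1][1,-1][-3,4][2,-2]_2[2,-2][-3,4][2,-2]$ $[1,-1]_{n+2}$. 11. $\frac{9}{7} \le \frac ab < \frac{4}{3}$; $s=8$, $k=8a-4b$, $\ell=a$ ($N=14$); $\varphi(n)$ is the word $[2,-2][1,-1][-2,3][1,-1]_2[2,-2][-1,2][1,-1]_2[1,-1][1,-1][0,1]_2[1,-1][1,-1]$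 $[1,-1][-1,2]_{n+2}$. 12. $\frac{11}{8} < \frac ab < \frac{3}{2}$, $\frac ab\notin\{\frac{7}{5},\frac{10}{7}\}$; $s=6$, $k=6a-b$, $\ell=6a-b$ ($N=14$); $\varphi(n)$ is the word $[1,-1][-6,9][8,-11][-1,2][2,-2][-1,2][-6,9][1,-1][6,-8][-4,6][-1,2][2,-2]$ $[-1,2][6,-8]_{n+1}$. 13. $\frac{7}{5} < \frac ab < \frac{10}{7}$; $s=6$, $k=6a-b$, $\ell=2a$ ($N=14$); $\varphi(n)$ is the word $[1,-1][-23,33][25,-35][-1,2][2,-2][-1,2][-23,33][1,-1][23,-32][-21,30][-1,2][2,-2]$ $[-1,2][23,-32]_{n+1}$. 14. $\frac{9}{8} < \frac ab < \frac{8}{7}$; $s=9$, $k=9a-7b$, $\ell=7a-7b$ ($N=16$); $\varphi(n)$ is the word $[9,-10][-6,7][8,-9][-6,7][8,-9][2,-2][1,-1][-6,7][2,-2][2,-2][3,-3][-6,7]$ $[2,-2][-6,7][1,-1][1,-1]_{n+1}$. 15. $\frac{10}{9} < \frac ab < \frac{9}{8}$, $\frac ab\notin\{\frac{19}{17}\}$;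 $s=10$, $k=10a-8b$, $\ell=6a-5b$ ($N=18$); $\varphi(n)$ is the word $[10,-11][-7,8][9,-10][2,-2][1,-1][2,-2][1,-1][-7,8][2,-2][3,-3][3,-3][-7,8]$ $[-7,8][1,-1][1,-1][10,-11][-8,9][1,-1]_{n+1}$. 16. $\frac{11}{10} < \frac ab < \frac{10}{9}$, $\frac ab\notin\{\frac{21}{19}\}$; $s=11$, $k=11a-9b$, $\ell=4a-3b$ ($N=20$); $\varphi(n)$ is the word $[11,-12][-8,9][10,-11][-8,9][10,-11][-8,9][10,-11][2,-2][1,-1][-8,9][2,-2][2,-2]$ $[2,-2][3,-3][-8,9][2,-2][2,-2][-8,9][1,-1][1,-1]_{n+1}$. 17. $\frac{13}{12} < \frac ab < \frac{12}{11}$, $\frac ab\notin\{\frac{25}{23}\}$; $s=13$, $k=13a-11b$, $\ell=4a-3b$ ($N=24$); $\varphi(n)$ is the word $[13,-14][-10,11][12,-13][-10,11][12,-13][-10,11][12,-13][-10,11][12,-13][2,-2][1,-1][-10,11]$ $[2,-2][2,-2][2,-2][2,-2][3,-3][-10,11][2,-2][2,-2][2,-2][-10,11][1,-1][1,-1]_{n+1}$.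 18. $\frac{7}{6} < \frac ab < \frac{6}{5}$, $\frac ab\notin\{\frac{13}{11},\frac{20}{17}\}$; $s=9$, $k=9a-4b$, $\ell=7a-6b$ ($N=26$); $\varphi(n)$ is the word $[7,-8][2,-2][-10,12][2,-2][7,-8][2,-2][-10,12][2,-2][7,-8][-5,6][7,-8][-10,12]$ $[12,-14][-10,12][2,-2][7,-8][2,-2][-10,12][2,-2][7,-8][2,-2][-10,12][12,-14][-10,12]$ $[7,-8][-5,6]_{n+1}$. 19. $\frac{8}{7} < \frac ab < \frac{6}{5}$; $s=14$, $k=14a-9b$, $\ell=6a-6b$ ($N=29$); $\varphi(n)$ is the word $[1,-1][1,-1]_2[2,-2][2,-2][-3,4][1,-1]_2[1,-1][2,-2][1,-1][1,-1][-3,4]_2[2,-2]_2$ $[2,-2][1,-1][1,-1][-5,6][7,-8][-5,6][1,-1]_2[2,-2]_2[1,-1][2,-2][-4,5][3,-3]$ $[2,-2][1,-1][-5,6][1,-1][1,-1]_{n+2}$. 20. $\frac{15}{13} < \frac ab < \frac{22}{19}$; $s=10$, $k=10a-5b$, $\ell=a$ ($N=30$); $\varphi(n)$ is the word $[-11,13][14,-16][-18,21][20,-23][2,-2][1,-1][-18,21][14,-16][2,-2][3,-3][-18,21][14,-16]$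 $[-18,21][1,-1][1,-1][21,-24][-18,21][14,-16][-12,14][2,-2][1,-1][14,-16][-18,21][2,-2]$ $[3,-3][14,-16][-18,21][14,-16][1,-1][1,-1]_{n+1}$. 21. $\frac{9}{7} < \frac ab < \frac{4}{3}$; $s=24$, $k=24a-15b$, $\ell=2a$ ($N=37$); $\varphi(n)$ is the word $[1,-1][2,-2][-1,2][2,-2][1,-1][-2,3][4,-5][-1,2][2,-2][1,-1][-2,3][-2,3]$ $[5,-6][-2,3][4,-5][1,-1][-2,3][3,-3][-2,3][1,-1][-3,4][5,-6][2,-2][1,-1]$ $[-2,3][3,-3][-2,3][4,-5][1,-1][-2,3][2,-2]_2[1,-1][-2,3][3,-3][-2,3][1,-1]$ $[1,-1]_{n+2}$. 22. $\frac{10}{9} < \frac ab < \frac{19}{17}$; $s=12$, $k=12a-7b$, $\ell=a$ ($N=38$); $\varphi(n)$ is the word $[19,-21][-16,18][10,-11][-8,9][10,-11][-8,9][2,-2][1,-1][10,-11][-16,18][2,-2][2,-2]$ $[3,-3][10,-11][-16,18][2,-2][10,-11][1,-1][1,-1][-7,8][10,-11][-16,18][18,-20][-16,18]$ $[18,-20][2,-2][1,-1][-16,18][10,-11][2,-2][2,-2][3,-3][-16,18][10,-11][2,-2][-16,18]$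 $[1,-1][1,-1]_{n+1}$. 23. $\frac{11}{10} < \frac ab < \frac{21}{19}$, $\frac ab\notin\{\frac{32}{29}\}$; $s=13$, $k=13a-8b$, $\ell=a$ ($N=42$); $\varphi(n)$ is the word $[21,-23][-18,20][11,-12][-9,10][2,-2][1,-1][2,-2][1,-1][11,-12][-18,20][2,-2][3,-3]$ $[3,-3][11,-12][-18,20][11,-12][1,-1][1,-1][-8,9][10,-11][1,-1][-8,9][11,-12][-18,20]$ $[20,-22][2,-2][1,-1][2,-2][1,-1][-18,20][11,-12][2,-2][3,-3][3,-3][-18,20][11,-12]$ $[-18,20][1,-1][1,-1][21,-23][-19,21][1,-1]_{n+1}$. 24. $\frac{12}{11} < \frac ab < \frac{23}{21}$; $s=14$, $k=14a-9b$, $\ell=10a-10b$ ($N=46$); $\varphi(n)$ is the word $[-9,10][2,-2][2,-2][12,-13][2,-2][2,-2][1,-1][-20,22][2,-2][2,-2][12,-13][-20,22]$ $[1,-1][24,-26][-20,22][22,-24][-20,22][22,-24][-20,22][12,-13][-10,11][-9,10][1,-1][23,-25]$ $[2,-2][2,-2][-20,22][2,-2][2,-2][1,-1][12,-13][2,-2][2,-2][-20,22][12,-13][1,-1]$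 $[-8,9][12,-13][-10,11][12,-13][-10,11][12,-13][-20,22][22,-24][-9,10][1,-1]_{n+1}$. 25. $\frac{23}{21} < \frac ab < \frac{34}{31}$; $s=14$, $k=14a-9b$, $\ell=a$ ($N=46$); $\varphi(n)$ is the word $[33,-36][-30,33][22,-24][-20,22][22,-24][-20,22][22,-24][-20,22][2,-2][1,-1][22,-24][-30,33]$ $[2,-2][2,-2][2,-2][3,-3][22,-24][-30,33][2,-2][2,-2][22,-24][1,-1][1,-1][-19,21]$ $[22,-24][-30,33][32,-35][-30,33][32,-35][-30,33][32,-35][2,-2][1,-1][-30,33][22,-24][2,-2]$ $[2,-2][2,-2][3,-3][-30,33][22,-24][2,-2][2,-2][-30,33][1,-1][1,-1]_{n+1}$. 26. $\frac{9}{8} < \frac ab < \frac{26}{23}$, $\frac ab\notin\{\frac{35}{31}\}$; $s=13$, $k=13a-5b$, $\ell=a$ ($N=54$); $\varphi(n)$ is the word $[25,-28][-22,25][9,-10][9,-10][-7,8][2,-2][1,-1][9,-10][-22,25][9,-10][2,-2][3,-3]$ $[9,-10][-22,25][9,-10][9,-10][1,-1][1,-1][-6,7][9,-10][-22,25][9,-10][-7,8][2,-2]$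 $[1,-1][9,-10][9,-10][-22,25][2,-2][3,-3][9,-10][9,-10][-22,25][9,-10][1,-1][1,-1]$ $[-6,7][9,-10][9,-10][-22,25][24,-27][2,-2][1,-1][-22,25][9,-10][9,-10][2,-2][3,-3]$ $[-22,25][9,-10][9,-10][-22,25][1,-1][1,-1]_{n+1}$. 27. $\frac{11}{9} < \frac ab < \frac{16}{13}$; $s=38$, $k=38a-15b$, $\ell=2a$ ($N=102$); $\varphi(n)$ is the word $[-7,9][10,-12][2,-2][1,-1][-12,15][10,-12][3,-3][-12,15][10,-12][-8,10][1,-1][10,-12]$ $[-12,15][2,-2]_2[1,-1][10,-12][-12,15][3,-3][10,-12][-12,15][1,-1][1,-1]_2[1,-1][10,-12]$ $[2,-2][-11,14][10,-12][2,-2][1,-1][-12,15][10,-12][-8,10][11,-13][-12,15][2,-2][1,-1]$ $[10,-12][-12,15][10,-12][-7,9][10,-12][-12,15][14,-17][1,-1][-12,15][10,-12][3,-3][-12,15]$ $[10,-12][1,-1][-13,16][15,-18][-12,15][2,-2][1,-1][10,-12][-12,15][3,-3][10,-12][-12,15]$ $[14,-17][1,-1][-12,15][10,-12][2,-2]_2[1,-1][-12,15][10,-12][3,-3][-12,15][10,-12][1,-1]$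 $[1,-1]_2[1,-1][-12,15][2,-2][11,-13][-12,15][2,-2][1,-1][10,-12][-12,15][14,-17][-11,14]$ $[10,-12][2,-2][1,-1][-12,15][10,-12][-12,15][15,-18][-12,15][10,-12][-8,10][1,-1][10,-12]$ $[-12,15][3,-3][10,-12][-12,15][1,-1][9,-11]_{n+1}$. 28. $\frac{9}{8} < \frac ab < \frac{17}{15}$, $\frac ab\notin\{\frac{26}{23}\}$; $s=53$, $k=53a-30b$, $\ell=8a-7b$ ($N=158$); $\varphi(n)$ is the word $[1,-1][9,-10][-7,8][1,-1][9,-10][2,-2][-13,15][2,-2]_2[1,-1][9,-10][2,-2][1,-1]$ $[-14,16][3,-3][9,-10][-7,8][10,-11][-14,16][1,-1][1,-1]_2[1,-1][2,-2][1,-1][9,-10]$ $[2,-2][-13,15][9,-10][-6,7][9,-10][2,-2][1,-1][-14,16][16,-18][1,-1][-14,16][9,-10]$ $[-7,8][10,-11][3,-3][-14,16][2,-2][1,-1][9,-10][1,-1][-15,17][17,-19][-14,16][9,-10]$ $[-6,7][2,-2][1,-1][9,-10][-14,16][16,-18][1,-1][-14,16][3,-3][9,-10][3,-3][-14,16]$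 $[16,-18][1,-1][-14,16][9,-10][1,-1][-15,17][17,-19][2,-2]_2[1,-1][-14,16][2,-2][1,-1]$ $[9,-10][3,-3][-14,16][3,-3][9,-10][1,-1][1,-1]_2[1,-1][-14,16][16,-18][1,-1][-14,16]$ $[2,-2][10,-11][2,-2]_2[1,-1][-14,16][2,-2][1,-1][9,-10][3,-3][-14,16][16,-18][-13,15]$ $[9,-10][1,-1][1,-1]_2[1,-1][2,-2][1,-1][-14,16][2,-2][10,-11][-14,16][17,-19][-14,16]$ $[2,-2][1,-1][9,-10][-7,8][1,-1][9,-10][-14,16][16,-18][-13,15][3,-3][9,-10][2,-2]$ $[1,-1][-14,16][1,-1][8,-9][-6,7][9,-10][-14,16][17,-19][2,-2][1,-1][-14,16][9,-10]$ $[-7,8][1,-1][9,-10][3,-3][-14,16][3,-3][9,-10][-7,8][1,-1][9,-10][-14,16][1,-1]$ $[8,-9][-6,7][2,-2]_2[1,-1][9,-10][2,-2][1,-1][-14,16][3,-3][9,-10][3,-3][-14,16]$ $[1,-1][1,-1]_{n+2}$. 29. $\frac{7}{6} < \frac ab < \frac{13}{11}$, $\frac ab\notin\{\frac{20}{17}\}$;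 $s=66$, $k=66a-28b$, $\ell=2a$ ($N=191$); $\varphi(n)$ is the word $[2,-2][7,-8][-10,12][7,-8][1,-1][-4,5][7,-8][-10,12][8,-9][-4,5][7,-8][-10,12]$ $[1,-1][7,-8][-5,6][6,-7][2,-2][-9,11][8,-9][-5,6][7,-8][1,-1][-10,12][1,-1]$ $[2,-2][8,-9][-9,11][2,-2][1,-1][7,-8][1,-1][-10,12][12,-14][-9,11][8,-9][2,-2]$ $[1,-1][-10,12][1,-1][7,-8][-10,12][13,-15][-9,11][7,-8][-5,6][1,-1][7,-8][1,-1]$ $[-10,12][3,-3][8,-9][-10,12][1,-1][6,-7][-4,5][1,-1][7,-8][2,-2][1,-1][-9,11]$ $[7,-8][3,-3][1,-1][-10,12][7,-8][-5,6][1,-1][8,-9][-10,12][2,-2]_2[1,-1][1,-1]$ $[7,-8][-10,12][3,-3]_2[1,-1][7,-8][-10,12][1,-1][3,-3][7,-8][2,-2][1,-1][1,-1]$ $[-10,12][7,-8][-9,11][13,-15][-10,12][7,-8][-5,6][-4,5][13,-15][-10,12][2,-2][-4,5]$ $[13,-15][-10,12][7,-8][1,-1][-10,12][12,-14][-11,13][13,-15][-3,4][-9,11][12,-14][-11,13]$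 $[1,-1][1,-1][7,-8][1,-1][3,-3][-10,12][8,-9][1,-1][2,-2][-10,12][1,-1][2,-2]$ $[1,-1][7,-8][-9,11][3,-3][7,-8][1,-1][-10,12][12,-14][1,-1][-10,12][8,-9][2,-2]_2$ $[1,-1][-10,12][1,-1][7,-8][3,-3][-9,11][7,-8][1,-1][1,-1]_2[1,-1][1,-1][-10,12]$ $[2,-2][8,-9]_2[1,-1][-10,12][2,-2][1,-1][8,-9][-10,12][12,-14][-9,11][1,-1][7,-8]$ $[2,-2][1,-1][-9,11][7,-8][-10,12][13,-15][1,-1][-10,12][7,-8][-5,6][1,-1][8,-9]$ $[-10,12][3,-3][1,-1][7,-8][-10,12][1,-1][6,-7][-3,4][7,-8][2,-2][1,-1][1,-1]$ $[-10,12][7,-8][-3,4][7,-8][-10,12][7,-8][-5,6][2,-2][7,-8][-10,12][2,-2]_{n+2}$. 30. $\frac{10}{9} < \frac ab < \frac{29}{26}$, $\frac ab\notin\{\frac{39}{35}\}$; $s=67$, $k=67a-30b$, $\ell=5a-4b$ ($N=279$); $\varphi(n)$ is the word $[-7,8][10,-11][10,-11][1,-1][-26,29][28,-31][2,-2][1,-1][-25,28][10,-11][2,-2][1,-1]$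 $[10,-11][3,-3][-25,28][10,-11][3,-3][10,-11][-8,9][1,-1][10,-11][-25,28][10,-11][-8,9]$ $[1,-1][10,-11][2,-2]_2[1,-1][10,-11][-25,28][2,-2]_2[1,-1][10,-11][3,-3][10,-11][-25,28]$ $[3,-3][10,-11][1,-1][1,-1]_2[1,-1][10,-11][-25,28][1,-1][1,-1]_2[1,-1][2,-2][11,-12]$ $[10,-11][2,-2][-24,27][2,-2][1,-1][10,-11][10,-11][2,-2][1,-1][-25,28][27,-30][-24,27]$ $[10,-11][10,-11][-8,9][11,-12][2,-2][1,-1][-25,28][10,-11][2,-2][1,-1][10,-11][-25,28]$ $[28,-31][-25,28][10,-11][10,-11][-7,8][10,-11][-8,9][1,-1][10,-11][-25,28][10,-11][-8,9]$ $[1,-1][10,-11][3,-3][10,-11][-25,28][3,-3][10,-11][1,-1][9,-10][-7,8][10,-11][-25,28]$ $[1,-1][9,-10][-7,8][2,-2][1,-1][10,-11][10,-11][2,-2][1,-1][-25,28][3,-3][10,-11]$ $[10,-11][3,-3][-25,28][27,-30][1,-1][-25,28][10,-11][10,-11][-8,9][1,-1][10,-11][2,-2]_2$ $[1,-1][-25,28][10,-11][2,-2]_2[1,-1][10,-11][3,-3][-25,28][10,-11][3,-3][10,-11][1,-1]$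 $[1,-1]_2[1,-1][-25,28][10,-11][1,-1][1,-1]_2[1,-1][2,-2][11,-12][-25,28][2,-2][11,-12]$ $[2,-2][1,-1][10,-11][-25,28][2,-2][1,-1][10,-11][-8,9][11,-12][10,-11][-25,28][27,-30]$ $[-24,27][2,-2][1,-1][10,-11][10,-11][2,-2][1,-1][-25,28][10,-11][-7,8][10,-11][10,-11]$ $[-25,28][28,-31][-25,28][27,-30][1,-1][-25,28][10,-11][10,-11][-8,9][1,-1][10,-11][3,-3]$ $[-25,28][10,-11][3,-3][10,-11][1,-1][-26,29][28,-31][-25,28][10,-11][1,-1][9,-10][-7,8]$ $[2,-2][1,-1][10,-11][-25,28][2,-2][1,-1][10,-11][3,-3][10,-11][-25,28][3,-3][10,-11]$ $[-8,9][1,-1][10,-11][10,-11][-25,28][27,-30][1,-1][-25,28][2,-2]_2[1,-1][10,-11][10,-11]$ $[2,-2]_2[1,-1][-25,28][3,-3][10,-11][10,-11][3,-3][-25,28][1,-1][1,-1]_2[1,-1][10,-11]$ $[10,-11][1,-1][1,-1]_2[1,-1][2,-2][-24,27][10,-11][2,-2][11,-12][2,-2][1,-1][-25,28]$ $[10,-11][2,-2][1,-1][10,-11][-8,9][11,-12][-25,28][10,-11][-8,9][11,-12][2,-2][1,-1]$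 $[10,-11][-25,28][2,-2][1,-1][10,-11][10,-11][-7,8][10,-11][-25,28][10,-11][-7,8][10,-11]$ $[-8,9][1,-1][10,-11][10,-11][-25,28][27,-30][1,-1][-25,28][3,-3][10,-11][10,-11][3,-3]$ $[-25,28][1,-1][9,-10]_{n+1}$. -/

import Mathlib

/-!
Words are finite lists of letters; the alphabet is `ℕ`.
-/

/-- The fractional power `v^(a/b) = v^⌊a/b⌋ v₀ v₁ ⋯ v_(l * frac(a/b) - 1)` of a word `v` whose
length `l` is divisible by `b`; here `l * frac(a/b) = l * (a % b) / b`. -/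
def fractionalPower {α : Type*} (v : List α) (a b : ℕ) : List α :=
  (List.replicate (a / b) v).flatten ++ v.take (v.length * (a % b) / b)

/-- `w` is an `a/b`-power: `w = v^(a/b)` for a nonempty word `v` whose length is divisible
by `b`. -/
def IsFractionalPower {α : Type*} (a b : ℕ) (w : List α) : Prop :=
  ∃ v : List α, v ≠ [] ∧ b ∣ v.length ∧ w = fractionalPower v a b

/-- No factor (contiguous subword) of `w` is an `a/b`-power. -/
def PowerFree {α : Type*} (a b : ℕ) (w : List α) : Prop :=
  ∀ x : List α, x <:+: w → ¬ IsFractionalPower a b x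

/-- The extension of a morphism, given on letters, to words by concatenation. -/
def applyMorphism {α : Type*} (φ : α → List α) (w : List α) : List α :=
  w.flatMap φ

/-- The morphism `φ` maps `a/b`-power-free words to `a/b`-power-free words. -/
def IsPowerFreeMorphism {α : Type*} (a b : ℕ) (φ : α → List α) : Prop :=
  ∀ w : List α, PowerFree a b w → PowerFree a b (applyMorphism φ w)

/-- `|φ(n)| = k` for every letter `n`. -/
def IsUniformMorphism {α : Type*} (k : ℕ) (φ : α → List α) : Prop :=
  ∀ n : α, (φ n).length = k

/-- There is `j` such that, for every word `w`, every occurrence of `x` as a factor of `φ(w)`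
begins at a position congruent to `j` modulo `k`. -/
def LocatesWord {α : Type*} (k : ℕ) (φ : α → List α) (x : List α) : Prop :=
  ∃ j : ℕ, ∀ w p q : List α, applyMorphism φ w = p ++ x ++ q → p.length ≡ j [MOD k]

/-- The `k`-uniform morphism `φ` locates words of length `l` (where `k ≥ 2` and `l ≥ 1`). -/
def LocatesWordsOfLength {α : Type*} (k l : ℕ) (φ : α → List α) : Prop :=
  2 ≤ k ∧ 1 ≤ l ∧ IsUniformMorphism k φ ∧ ∀ x : List α, x.length = l → LocatesWord k φ x

/-- The data of a morphism symbolic in `a, b`, with the conditions on `a/b` and the constants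
that go with it:
* `a/b` lies between `lo` (included or not, according to `loIncluded`) and `hi` (not included),
  and is not one of the rationals in `excluded`;
* the morphism is `(s a - t b)`-uniform and `gcd (b, s) = 1` is required (no condition if `s = 1`);
* `c a - e b` is the locating length;
* `nonzeroLetters` is the number of nonzero letters in each image `φ(n)`;
* a triple `(i, j, x)` in `blocks` stands for the word `0^(i a + j b - 1) x`, and the pair
  `last = (i, j)` stands for the final word `0^(i a + j b - 1) (n + d)` of `φ(n)`. -/
structure SymbolicMorphism where
  lo : ℚ
  loIncluded : Prop
  hi : ℚ
  excluded : List ℚ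
  s : ℕ
  t : ℕ
  c : ℕ
  e : ℕ
  nonzeroLetters : ℕ
  blocks : List (ℤ × ℤ × ℕ)
  last : ℤ × ℤ
  d : ℕ

namespace SymbolicMorphism

/-- The run length `i a + j b - 1`. -/
def runLength (a b : ℕ) (i j : ℤ) : ℤ := i * a + j * b - 1

/-- The word `0^(i a + j b - 1) x`. -/
def block (a b : ℕ) (i j : ℤ) (x : ℕ) : List ℕ :=
  List.replicate (runLength a b i j).toNat 0 ++ [x]

/-- The morphism `φ` on the alphabet `ℕ` for given values of `a` and `b`. -/
def morphism (F : SymbolicMorphism) (a b : ℕ) (n : ℕ) : List ℕ :=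
  F.blocks.flatMap (fun r => block a b r.1 r.2.1 r.2.2) ++ block a b F.last.1 F.last.2 (n + F.d)

/-- All run lengths in the symbolic expression of `φ` are nonnegative, so that it makes sense. -/
def RunLengthsNonneg (F : SymbolicMorphism) (a b : ℕ) : Prop :=
  (∀ r ∈ F.blocks, 0 ≤ runLength a b r.1 r.2.1) ∧ 0 ≤ runLength a b F.last.1 F.last.2

/-- The conditions on `a` and `b`. -/
def Admissible (F : SymbolicMorphism) (a b : ℕ) : Prop :=
  0 < a ∧ 0 < b ∧ Nat.Coprime a b ∧
    (F.lo < (a : ℚ) / b ∨ F.loIncluded ∧ F.lo = (a : ℚ) / b) ∧ (a : ℚ) / b < F.hi ∧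
    (a : ℚ) / b ∉ F.excluded ∧ Nat.gcd b F.s = 1

end SymbolicMorphism

def fam_2_2a_b : SymbolicMorphism where
  lo := 5 / 3
  loIncluded := True
  hi := 2
  excluded := []
  s := 2
  t := 1
  c := 1
  e := 0
  nonzeroLetters := 2
  blocks := [(1, 0, 1)]
  last := (1, -1)
  d := 1

def fam_3_a : SymbolicMorphism where
  lo := 5 / 4
  loIncluded := False
  hi := 4 / 3
  excluded := []
  s := 1
  t := 0
  c := 3
  e := 3
  nonzeroLetters := 3
  blocks := [(5, -6, 1), (-2, 3, 1)]
  last := (-2, 3)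
  d := 2

def fam_4_5a_4b : SymbolicMorphism where
  lo := 3 / 2
  loIncluded := False
  hi := 5 / 3
  excluded := []
  s := 5
  t := 4
  c := 5
  e := 5
  nonzeroLetters := 4
  blocks := [(1, 0, 1), (1, -1, 1), (2, -2, 1)]
  last := (1, -1)
  d := 1

def fam_4_a : SymbolicMorphism where
  lo := 6 / 5
  loIncluded := False
  hi := 5 / 4
  excluded := [11 / 9, 17 / 14]
  s := 1
  t := 0
  c := 1
  e := 0
  nonzeroLetters := 4
  blocks := [(6, -7, 1), (-3, 4, 1), (-8, 10, 1)]
  last := (6, -7)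
  d := 1

def fam_6_4a_2b_I : SymbolicMorphism where
  lo := 4 / 3
  loIncluded := False
  hi := 2
  excluded := [5 / 3, 7 / 5]
  s := 4
  t := 2
  c := 5
  e := 4
  nonzeroLetters := 6
  blocks := [(2, -2, 1), (-1, 2, 1), (3, -4, 1), (-1, 2, 1), (2, -2, 1)]
  last := (-1, 2)
  d := 1

def fam_6_4a_2b_II : SymbolicMorphism where
  lo := 4 / 3
  loIncluded := False
  hi := 2
  excluded := [5 / 3, 7 / 5]
  s := 4
  t := 2
  c := 5
  e := 4
  nonzeroLetters := 6
  blocks := [(-1, 2, 1), (2, -2, 1), (-1, 2, 1), (2, -2, 1), (-1, 2, 1)]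
  last := (3, -4)
  d := 1

def fam_8_5a_3b : SymbolicMorphism where
  lo := 5 / 4
  loIncluded := False
  hi := 4 / 3
  excluded := [9 / 7]
  s := 5
  t := 3
  c := 6
  e := 6
  nonzeroLetters := 8
  blocks := [(5, -6, 1), (2, -2, 1), (1, -1, 1), (-2, 3, 1), (3, -3, 1), (-6, 8, 1), (1, -1, 1)]
  last := (1, -1)
  d := 1

def fam_10_11a_10b : SymbolicMorphism where
  lo := 6 / 5
  loIncluded := False
  hi := 5 / 4
  excluded := [11 / 9, 16 / 13, 17 / 14, 23 / 19]
  s := 11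
  t := 10
  c := 7
  e := 7
  nonzeroLetters := 10
  blocks := [(-2, 3, 1), (3, -3, 1), (1, -1, 1), (-3, 4, 1), (5, -6, 1), (1, -1, 1), (2, -2, 1),
    (1, -1, 1), (2, -2, 1)]
  last := (1, -1)
  d := 1

def fam_12_7a_5b : SymbolicMorphism where
  lo := 7 / 6
  loIncluded := False
  hi := 6 / 5
  excluded := [13 / 11]
  s := 7
  t := 5
  c := 5
  e := 3
  nonzeroLetters := 12
  blocks := [(7, -8, 1), (-4, 5, 1), (6, -7, 1), (2, -2, 1), (1, -1, 1), (-4, 5, 1), (2, -2, 1),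
    (3, -3, 1), (-4, 5, 1), (-4, 5, 1), (1, -1, 1)]
  last := (1, -1)
  d := 1

def fam_13_7a_4b : SymbolicMorphism where
  lo := 6 / 5
  loIncluded := False
  hi := 5 / 4
  excluded := []
  s := 7
  t := 4
  c := 5
  e := 5
  nonzeroLetters := 13
  blocks := [(1, -1, 1), (-3, 4, 1), (4, -4, 1), (-3, 4, 1), (5, -6, 1), (1, -1, 1), (1, -1, 1),
    (-3, 4, 1), (2, -2, 2), (2, -2, 1), (-3, 4, 1), (2, -2, 1)]
  last := (1, -1)
  d := 2

def fam_14_8a_4b : SymbolicMorphism where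
  lo := 9 / 7
  loIncluded := True
  hi := 4 / 3
  excluded := []
  s := 8
  t := 4
  c := 1
  e := 0
  nonzeroLetters := 14
  blocks := [(2, -2, 1), (1, -1, 1), (-2, 3, 1), (1, -1, 2), (2, -2, 1), (-1, 2, 1), (1, -1, 2),
    (1, -1, 1), (1, -1, 1), (0, 1, 2), (1, -1, 1), (1, -1, 1), (1, -1, 1)]
  last := (-1, 2)
  d := 2

def fam_14_6a_b_I : SymbolicMorphism where
  lo := 11 / 8
  loIncluded := False
  hi := 3 / 2
  excluded := [7 / 5, 10 / 7]
  s := 6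
  t := 1
  c := 6
  e := 1
  nonzeroLetters := 14
  blocks := [(1, -1, 1), (-6, 9, 1), (8, -11, 1), (-1, 2, 1), (2, -2, 1), (-1, 2, 1), (-6, 9, 1),
    (1, -1, 1), (6, -8, 1), (-4, 6, 1), (-1, 2, 1), (2, -2, 1), (-1, 2, 1)]
  last := (6, -8)
  d := 1

def fam_14_6a_b_II : SymbolicMorphism where
  lo := 7 / 5
  loIncluded := False
  hi := 10 / 7
  excluded := []
  s := 6
  t := 1
  c := 2
  e := 0
  nonzeroLetters := 14
  blocks := [(1, -1, 1), (-23, 33, 1), (25, -35, 1), (-1, 2, 1), (2, -2, 1), (-1, 2, 1),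
    (-23, 33, 1), (1, -1, 1), (23, -32, 1), (-21, 30, 1), (-1, 2, 1), (2, -2, 1), (-1, 2, 1)]
  last := (23, -32)
  d := 1

def fam_16_9a_7b : SymbolicMorphism where
  lo := 9 / 8
  loIncluded := False
  hi := 8 / 7
  excluded := []
  s := 9
  t := 7
  c := 7
  e := 7
  nonzeroLetters := 16
  blocks := [(9, -10, 1), (-6, 7, 1), (8, -9, 1), (-6, 7, 1), (8, -9, 1), (2, -2, 1), (1, -1, 1),
    (-6, 7, 1), (2, -2, 1), (2, -2, 1), (3, -3, 1), (-6, 7, 1), (2, -2, 1), (-6, 7, 1),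
    (1, -1, 1)]
  last := (1, -1)
  d := 1

def fam_18_10a_8b : SymbolicMorphism where
  lo := 10 / 9
  loIncluded := False
  hi := 9 / 8
  excluded := [19 / 17]
  s := 10
  t := 8
  c := 6
  e := 5
  nonzeroLetters := 18
  blocks := [(10, -11, 1), (-7, 8, 1), (9, -10, 1), (2, -2, 1), (1, -1, 1), (2, -2, 1),
    (1, -1, 1), (-7, 8, 1), (2, -2, 1), (3, -3, 1), (3, -3, 1), (-7, 8, 1), (-7, 8, 1),
    (1, -1, 1), (1, -1, 1), (10, -11, 1), (-8, 9, 1)]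
  last := (1, -1)
  d := 1

def fam_20_11a_9b : SymbolicMorphism where
  lo := 11 / 10
  loIncluded := False
  hi := 10 / 9
  excluded := [21 / 19]
  s := 11
  t := 9
  c := 4
  e := 3
  nonzeroLetters := 20
  blocks := [(11, -12, 1), (-8, 9, 1), (10, -11, 1), (-8, 9, 1), (10, -11, 1), (-8, 9, 1),
    (10, -11, 1), (2, -2, 1), (1, -1, 1), (-8, 9, 1), (2, -2, 1), (2, -2, 1), (2, -2, 1),
    (3, -3, 1), (-8, 9, 1), (2, -2, 1), (2, -2, 1), (-8, 9, 1), (1, -1, 1)]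
  last := (1, -1)
  d := 1

def fam_24_13a_11b : SymbolicMorphism where
  lo := 13 / 12
  loIncluded := False
  hi := 12 / 11
  excluded := [25 / 23]
  s := 13
  t := 11
  c := 4
  e := 3
  nonzeroLetters := 24
  blocks := [(13, -14, 1), (-10, 11, 1), (12, -13, 1), (-10, 11, 1), (12, -13, 1), (-10, 11, 1),
    (12, -13, 1), (-10, 11, 1), (12, -13, 1), (2, -2, 1), (1, -1, 1), (-10, 11, 1), (2, -2, 1),
    (2, -2, 1), (2, -2, 1), (2, -2, 1), (3, -3, 1), (-10, 11, 1), (2, -2, 1), (2, -2, 1),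
    (2, -2, 1), (-10, 11, 1), (1, -1, 1)]
  last := (1, -1)
  d := 1

def fam_26_9a_4b : SymbolicMorphism where
  lo := 7 / 6
  loIncluded := False
  hi := 6 / 5
  excluded := [13 / 11, 20 / 17]
  s := 9
  t := 4
  c := 7
  e := 6
  nonzeroLetters := 26
  blocks := [(7, -8, 1), (2, -2, 1), (-10, 12, 1), (2, -2, 1), (7, -8, 1), (2, -2, 1),
    (-10, 12, 1), (2, -2, 1), (7, -8, 1), (-5, 6, 1), (7, -8, 1), (-10, 12, 1), (12, -14, 1),
    (-10, 12, 1), (2, -2, 1), (7, -8, 1), (2, -2, 1), (-10, 12, 1), (2, -2, 1), (7, -8, 1),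
    (2, -2, 1), (-10, 12, 1), (12, -14, 1), (-10, 12, 1), (7, -8, 1)]
  last := (-5, 6)
  d := 1

def fam_29_14a_9b : SymbolicMorphism where
  lo := 8 / 7
  loIncluded := False
  hi := 6 / 5
  excluded := []
  s := 14
  t := 9
  c := 6
  e := 6
  nonzeroLetters := 29
  blocks := [(1, -1, 1), (1, -1, 2), (2, -2, 1), (2, -2, 1), (-3, 4, 1), (1, -1, 2), (1, -1, 1),
    (2, -2, 1), (1, -1, 1), (1, -1, 1), (-3, 4, 2), (2, -2, 2), (2, -2, 1), (1, -1, 1),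
    (1, -1, 1), (-5, 6, 1), (7, -8, 1), (-5, 6, 1), (1, -1, 2), (2, -2, 2), (1, -1, 1),
    (2, -2, 1), (-4, 5, 1), (3, -3, 1), (2, -2, 1), (1, -1, 1), (-5, 6, 1), (1, -1, 1)]
  last := (1, -1)
  d := 2

def fam_30_10a_5b : SymbolicMorphism where
  lo := 15 / 13
  loIncluded := False
  hi := 22 / 19
  excluded := []
  s := 10
  t := 5
  c := 1
  e := 0
  nonzeroLetters := 30
  blocks := [(-11, 13, 1), (14, -16, 1), (-18, 21, 1), (20, -23, 1), (2, -2, 1), (1, -1, 1),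
    (-18, 21, 1), (14, -16, 1), (2, -2, 1), (3, -3, 1), (-18, 21, 1), (14, -16, 1), (-18, 21, 1),
    (1, -1, 1), (1, -1, 1), (21, -24, 1), (-18, 21, 1), (14, -16, 1), (-12, 14, 1), (2, -2, 1),
    (1, -1, 1), (14, -16, 1), (-18, 21, 1), (2, -2, 1), (3, -3, 1), (14, -16, 1), (-18, 21, 1),
    (14, -16, 1), (1, -1, 1)]
  last := (1, -1)
  d := 1

def fam_37_24a_15b : SymbolicMorphism where
  lo := 9 / 7
  loIncluded := False
  hi := 4 / 3
  excluded := []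
  s := 24
  t := 15
  c := 2
  e := 0
  nonzeroLetters := 37
  blocks := [(1, -1, 1), (2, -2, 1), (-1, 2, 1), (2, -2, 1), (1, -1, 1), (-2, 3, 1), (4, -5, 1),
    (-1, 2, 1), (2, -2, 1), (1, -1, 1), (-2, 3, 1), (-2, 3, 1), (5, -6, 1), (-2, 3, 1),
    (4, -5, 1), (1, -1, 1), (-2, 3, 1), (3, -3, 1), (-2, 3, 1), (1, -1, 1), (-3, 4, 1),
    (5, -6, 1), (2, -2, 1), (1, -1, 1), (-2, 3, 1), (3, -3, 1), (-2, 3, 1), (4, -5, 1),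
    (1, -1, 1), (-2, 3, 1), (2, -2, 2), (1, -1, 1), (-2, 3, 1), (3, -3, 1), (-2, 3, 1),
    (1, -1, 1)]
  last := (1, -1)
  d := 2

def fam_38_12a_7b : SymbolicMorphism where
  lo := 10 / 9
  loIncluded := False
  hi := 19 / 17
  excluded := []
  s := 12
  t := 7
  c := 1
  e := 0
  nonzeroLetters := 38
  blocks := [(19, -21, 1), (-16, 18, 1), (10, -11, 1), (-8, 9, 1), (10, -11, 1), (-8, 9, 1),
    (2, -2, 1), (1, -1, 1), (10, -11, 1), (-16, 18, 1), (2, -2, 1), (2, -2, 1), (3, -3, 1),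
    (10, -11, 1), (-16, 18, 1), (2, -2, 1), (10, -11, 1), (1, -1, 1), (1, -1, 1), (-7, 8, 1),
    (10, -11, 1), (-16, 18, 1), (18, -20, 1), (-16, 18, 1), (18, -20, 1), (2, -2, 1), (1, -1, 1),
    (-16, 18, 1), (10, -11, 1), (2, -2, 1), (2, -2, 1), (3, -3, 1), (-16, 18, 1), (10, -11, 1),
    (2, -2, 1), (-16, 18, 1), (1, -1, 1)]
  last := (1, -1)
  d := 1

def fam_42_13a_8b : SymbolicMorphism where
  lo := 11 / 10
  loIncluded := False
  hi := 21 / 19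
  excluded := [32 / 29]
  s := 13
  t := 8
  c := 1
  e := 0
  nonzeroLetters := 42
  blocks := [(21, -23, 1), (-18, 20, 1), (11, -12, 1), (-9, 10, 1), (2, -2, 1), (1, -1, 1),
    (2, -2, 1), (1, -1, 1), (11, -12, 1), (-18, 20, 1), (2, -2, 1), (3, -3, 1), (3, -3, 1),
    (11, -12, 1), (-18, 20, 1), (11, -12, 1), (1, -1, 1), (1, -1, 1), (-8, 9, 1), (10, -11, 1),
    (1, -1, 1), (-8, 9, 1), (11, -12, 1), (-18, 20, 1), (20, -22, 1), (2, -2, 1), (1, -1, 1),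
    (2, -2, 1), (1, -1, 1), (-18, 20, 1), (11, -12, 1), (2, -2, 1), (3, -3, 1), (3, -3, 1),
    (-18, 20, 1), (11, -12, 1), (-18, 20, 1), (1, -1, 1), (1, -1, 1), (21, -23, 1), (-19, 21, 1)]
  last := (1, -1)
  d := 1

def fam_46_14a_9b_I : SymbolicMorphism where
  lo := 12 / 11
  loIncluded := False
  hi := 23 / 21
  excluded := []
  s := 14
  t := 9
  c := 10
  e := 10
  nonzeroLetters := 46
  blocks := [(-9, 10, 1), (2, -2, 1), (2, -2, 1), (12, -13, 1), (2, -2, 1), (2, -2, 1),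
    (1, -1, 1), (-20, 22, 1), (2, -2, 1), (2, -2, 1), (12, -13, 1), (-20, 22, 1), (1, -1, 1),
    (24, -26, 1), (-20, 22, 1), (22, -24, 1), (-20, 22, 1), (22, -24, 1), (-20, 22, 1),
    (12, -13, 1), (-10, 11, 1), (-9, 10, 1), (1, -1, 1), (23, -25, 1), (2, -2, 1), (2, -2, 1),
    (-20, 22, 1), (2, -2, 1), (2, -2, 1), (1, -1, 1), (12, -13, 1), (2, -2, 1), (2, -2, 1),
    (-20, 22, 1), (12, -13, 1), (1, -1, 1), (-8, 9, 1), (12, -13, 1), (-10, 11, 1), (12, -13, 1),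
    (-10, 11, 1), (12, -13, 1), (-20, 22, 1), (22, -24, 1), (-9, 10, 1)]
  last := (1, -1)
  d := 1

def fam_46_14a_9b_II : SymbolicMorphism where
  lo := 23 / 21
  loIncluded := False
  hi := 34 / 31
  excluded := []
  s := 14
  t := 9
  c := 1
  e := 0
  nonzeroLetters := 46
  blocks := [(33, -36, 1), (-30, 33, 1), (22, -24, 1), (-20, 22, 1), (22, -24, 1), (-20, 22, 1),
    (22, -24, 1), (-20, 22, 1), (2, -2, 1), (1, -1, 1), (22, -24, 1), (-30, 33, 1), (2, -2, 1),
    (2, -2, 1), (2, -2, 1), (3, -3, 1), (22, -24, 1), (-30, 33, 1), (2, -2, 1), (2, -2, 1),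
    (22, -24, 1), (1, -1, 1), (1, -1, 1), (-19, 21, 1), (22, -24, 1), (-30, 33, 1), (32, -35, 1),
    (-30, 33, 1), (32, -35, 1), (-30, 33, 1), (32, -35, 1), (2, -2, 1), (1, -1, 1), (-30, 33, 1),
    (22, -24, 1), (2, -2, 1), (2, -2, 1), (2, -2, 1), (3, -3, 1), (-30, 33, 1), (22, -24, 1),
    (2, -2, 1), (2, -2, 1), (-30, 33, 1), (1, -1, 1)]
  last := (1, -1)
  d := 1

def fam_54_13a_5b : SymbolicMorphism where
  lo := 9 / 8
  loIncluded := False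
  hi := 26 / 23
  excluded := [35 / 31]
  s := 13
  t := 5
  c := 1
  e := 0
  nonzeroLetters := 54
  blocks := [(25, -28, 1), (-22, 25, 1), (9, -10, 1), (9, -10, 1), (-7, 8, 1), (2, -2, 1),
    (1, -1, 1), (9, -10, 1), (-22, 25, 1), (9, -10, 1), (2, -2, 1), (3, -3, 1), (9, -10, 1),
    (-22, 25, 1), (9, -10, 1), (9, -10, 1), (1, -1, 1), (1, -1, 1), (-6, 7, 1), (9, -10, 1),
    (-22, 25, 1), (9, -10, 1), (-7, 8, 1), (2, -2, 1), (1, -1, 1), (9, -10, 1), (9, -10, 1),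
    (-22, 25, 1), (2, -2, 1), (3, -3, 1), (9, -10, 1), (9, -10, 1), (-22, 25, 1), (9, -10, 1),
    (1, -1, 1), (1, -1, 1), (-6, 7, 1), (9, -10, 1), (9, -10, 1), (-22, 25, 1), (24, -27, 1),
    (2, -2, 1), (1, -1, 1), (-22, 25, 1), (9, -10, 1), (9, -10, 1), (2, -2, 1), (3, -3, 1),
    (-22, 25, 1), (9, -10, 1), (9, -10, 1), (-22, 25, 1), (1, -1, 1)]
  last := (1, -1)
  d := 1

def fam_102_38a_15b : SymbolicMorphism where
  lo := 11 / 9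
  loIncluded := False
  hi := 16 / 13
  excluded := []
  s := 38
  t := 15
  c := 2
  e := 0
  nonzeroLetters := 102
  blocks := [(-7, 9, 1), (10, -12, 1), (2, -2, 1), (1, -1, 1), (-12, 15, 1), (10, -12, 1),
    (3, -3, 1), (-12, 15, 1), (10, -12, 1), (-8, 10, 1), (1, -1, 1), (10, -12, 1), (-12, 15, 1),
    (2, -2, 2), (1, -1, 1), (10, -12, 1), (-12, 15, 1), (3, -3, 1), (10, -12, 1), (-12, 15, 1),
    (1, -1, 1), (1, -1, 2), (1, -1, 1), (10, -12, 1), (2, -2, 1), (-11, 14, 1), (10, -12, 1),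
    (2, -2, 1), (1, -1, 1), (-12, 15, 1), (10, -12, 1), (-8, 10, 1), (11, -13, 1), (-12, 15, 1),
    (2, -2, 1), (1, -1, 1), (10, -12, 1), (-12, 15, 1), (10, -12, 1), (-7, 9, 1), (10, -12, 1),
    (-12, 15, 1), (14, -17, 1), (1, -1, 1), (-12, 15, 1), (10, -12, 1), (3, -3, 1), (-12, 15, 1),
    (10, -12, 1), (1, -1, 1), (-13, 16, 1), (15, -18, 1), (-12, 15, 1), (2, -2, 1), (1, -1, 1),
    (10, -12, 1), (-12, 15, 1), (3, -3, 1), (10, -12, 1), (-12, 15, 1), (14, -17, 1), (1, -1, 1),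
    (-12, 15, 1), (10, -12, 1), (2, -2, 2), (1, -1, 1), (-12, 15, 1), (10, -12, 1), (3, -3, 1),
    (-12, 15, 1), (10, -12, 1), (1, -1, 1), (1, -1, 2), (1, -1, 1), (-12, 15, 1), (2, -2, 1),
    (11, -13, 1), (-12, 15, 1), (2, -2, 1), (1, -1, 1), (10, -12, 1), (-12, 15, 1), (14, -17, 1),
    (-11, 14, 1), (10, -12, 1), (2, -2, 1), (1, -1, 1), (-12, 15, 1), (10, -12, 1), (-12, 15, 1),
    (15, -18, 1), (-12, 15, 1), (10, -12, 1), (-8, 10, 1), (1, -1, 1), (10, -12, 1),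
    (-12, 15, 1), (3, -3, 1), (10, -12, 1), (-12, 15, 1), (1, -1, 1)]
  last := (9, -11)
  d := 1

def fam_158_53a_30b : SymbolicMorphism where
  lo := 9 / 8
  loIncluded := False
  hi := 17 / 15
  excluded := [26 / 23]
  s := 53
  t := 30
  c := 8
  e := 7
  nonzeroLetters := 158
  blocks := [(1, -1, 1), (9, -10, 1), (-7, 8, 1), (1, -1, 1), (9, -10, 1), (2, -2, 1),
    (-13, 15, 1), (2, -2, 2), (1, -1, 1), (9, -10, 1), (2, -2, 1), (1, -1, 1), (-14, 16, 1),
    (3, -3, 1), (9, -10, 1), (-7, 8, 1), (10, -11, 1), (-14, 16, 1), (1, -1, 1), (1, -1, 2),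
    (1, -1, 1), (2, -2, 1), (1, -1, 1), (9, -10, 1), (2, -2, 1), (-13, 15, 1), (9, -10, 1),
    (-6, 7, 1), (9, -10, 1), (2, -2, 1), (1, -1, 1), (-14, 16, 1), (16, -18, 1), (1, -1, 1),
    (-14, 16, 1), (9, -10, 1), (-7, 8, 1), (10, -11, 1), (3, -3, 1), (-14, 16, 1), (2, -2, 1),
    (1, -1, 1), (9, -10, 1), (1, -1, 1), (-15, 17, 1), (17, -19, 1), (-14, 16, 1), (9, -10, 1),
    (-6, 7, 1), (2, -2, 1), (1, -1, 1), (9, -10, 1), (-14, 16, 1), (16, -18, 1), (1, -1, 1),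
    (-14, 16, 1), (3, -3, 1), (9, -10, 1), (3, -3, 1), (-14, 16, 1), (16, -18, 1), (1, -1, 1),
    (-14, 16, 1), (9, -10, 1), (1, -1, 1), (-15, 17, 1), (17, -19, 1), (2, -2, 2), (1, -1, 1),
    (-14, 16, 1), (2, -2, 1), (1, -1, 1), (9, -10, 1), (3, -3, 1), (-14, 16, 1), (3, -3, 1),
    (9, -10, 1), (1, -1, 1), (1, -1, 2), (1, -1, 1), (-14, 16, 1), (16, -18, 1), (1, -1, 1),
    (-14, 16, 1), (2, -2, 1), (10, -11, 1), (2, -2, 2), (1, -1, 1), (-14, 16, 1), (2, -2, 1),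
    (1, -1, 1), (9, -10, 1), (3, -3, 1), (-14, 16, 1), (16, -18, 1), (-13, 15, 1), (9, -10, 1),
    (1, -1, 1), (1, -1, 2), (1, -1, 1), (2, -2, 1), (1, -1, 1), (-14, 16, 1), (2, -2, 1),
    (10, -11, 1), (-14, 16, 1), (17, -19, 1), (-14, 16, 1), (2, -2, 1), (1, -1, 1), (9, -10, 1),
    (-7, 8, 1), (1, -1, 1), (9, -10, 1), (-14, 16, 1), (16, -18, 1), (-13, 15, 1), (3, -3, 1),
    (9, -10, 1), (2, -2, 1), (1, -1, 1), (-14, 16, 1), (1, -1, 1), (8, -9, 1), (-6, 7, 1),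
    (9, -10, 1), (-14, 16, 1), (17, -19, 1), (2, -2, 1), (1, -1, 1), (-14, 16, 1), (9, -10, 1),
    (-7, 8, 1), (1, -1, 1), (9, -10, 1), (3, -3, 1), (-14, 16, 1), (3, -3, 1), (9, -10, 1),
    (-7, 8, 1), (1, -1, 1), (9, -10, 1), (-14, 16, 1), (1, -1, 1), (8, -9, 1), (-6, 7, 1),
    (2, -2, 2), (1, -1, 1), (9, -10, 1), (2, -2, 1), (1, -1, 1), (-14, 16, 1), (3, -3, 1),
    (9, -10, 1), (3, -3, 1), (-14, 16, 1), (1, -1, 1)]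
  last := (1, -1)
  d := 2

def fam_191_66a_28b : SymbolicMorphism where
  lo := 7 / 6
  loIncluded := False
  hi := 13 / 11
  excluded := [20 / 17]
  s := 66
  t := 28
  c := 2
  e := 0
  nonzeroLetters := 191
  blocks := [(2, -2, 1), (7, -8, 1), (-10, 12, 1), (7, -8, 1), (1, -1, 1), (-4, 5, 1),
    (7, -8, 1), (-10, 12, 1), (8, -9, 1), (-4, 5, 1), (7, -8, 1), (-10, 12, 1), (1, -1, 1),
    (7, -8, 1), (-5, 6, 1), (6, -7, 1), (2, -2, 1), (-9, 11, 1), (8, -9, 1), (-5, 6, 1),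
    (7, -8, 1), (1, -1, 1), (-10, 12, 1), (1, -1, 1), (2, -2, 1), (8, -9, 1), (-9, 11, 1),
    (2, -2, 1), (1, -1, 1), (7, -8, 1), (1, -1, 1), (-10, 12, 1), (12, -14, 1), (-9, 11, 1),
    (8, -9, 1), (2, -2, 1), (1, -1, 1), (-10, 12, 1), (1, -1, 1), (7, -8, 1), (-10, 12, 1),
    (13, -15, 1), (-9, 11, 1), (7, -8, 1), (-5, 6, 1), (1, -1, 1), (7, -8, 1), (1, -1, 1),
    (-10, 12, 1), (3, -3, 1), (8, -9, 1), (-10, 12, 1), (1, -1, 1), (6, -7, 1), (-4, 5, 1),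
    (1, -1, 1), (7, -8, 1), (2, -2, 1), (1, -1, 1), (-9, 11, 1), (7, -8, 1), (3, -3, 1),
    (1, -1, 1), (-10, 12, 1), (7, -8, 1), (-5, 6, 1), (1, -1, 1), (8, -9, 1), (-10, 12, 1),
    (2, -2, 2), (1, -1, 1), (1, -1, 1), (7, -8, 1), (-10, 12, 1), (3, -3, 2), (1, -1, 1),
    (7, -8, 1), (-10, 12, 1), (1, -1, 1), (3, -3, 1), (7, -8, 1), (2, -2, 1), (1, -1, 1),
    (1, -1, 1), (-10, 12, 1), (7, -8, 1), (-9, 11, 1), (13, -15, 1), (-10, 12, 1), (7, -8, 1),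
    (-5, 6, 1), (-4, 5, 1), (13, -15, 1), (-10, 12, 1), (2, -2, 1), (-4, 5, 1), (13, -15, 1),
    (-10, 12, 1), (7, -8, 1), (1, -1, 1), (-10, 12, 1), (12, -14, 1), (-11, 13, 1), (13, -15, 1),
    (-3, 4, 1), (-9, 11, 1), (12, -14, 1), (-11, 13, 1), (1, -1, 1), (1, -1, 1), (7, -8, 1),
    (1, -1, 1), (3, -3, 1), (-10, 12, 1), (8, -9, 1), (1, -1, 1), (2, -2, 1), (-10, 12, 1),
    (1, -1, 1), (2, -2, 1), (1, -1, 1), (7, -8, 1), (-9, 11, 1), (3, -3, 1), (7, -8, 1),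
    (1, -1, 1), (-10, 12, 1), (12, -14, 1), (1, -1, 1), (-10, 12, 1), (8, -9, 1), (2, -2, 2),
    (1, -1, 1), (-10, 12, 1), (1, -1, 1), (7, -8, 1), (3, -3, 1), (-9, 11, 1), (7, -8, 1),
    (1, -1, 1), (1, -1, 2), (1, -1, 1), (1, -1, 1), (-10, 12, 1), (2, -2, 1), (8, -9, 2),
    (1, -1, 1), (-10, 12, 1), (2, -2, 1), (1, -1, 1), (8, -9, 1), (-10, 12, 1), (12, -14, 1),
    (-9, 11, 1), (1, -1, 1), (7, -8, 1), (2, -2, 1), (1, -1, 1), (-9, 11, 1), (7, -8, 1),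
    (-10, 12, 1), (13, -15, 1), (1, -1, 1), (-10, 12, 1), (7, -8, 1), (-5, 6, 1), (1, -1, 1),
    (8, -9, 1), (-10, 12, 1), (3, -3, 1), (1, -1, 1), (7, -8, 1), (-10, 12, 1), (1, -1, 1),
    (6, -7, 1), (-3, 4, 1), (7, -8, 1), (2, -2, 1), (1, -1, 1), (1, -1, 1), (-10, 12, 1),
    (7, -8, 1), (-3, 4, 1), (7, -8, 1), (-10, 12, 1), (7, -8, 1), (-5, 6, 1), (2, -2, 1),
    (7, -8, 1), (-10, 12, 1)]
  last := (2, -2)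
  d := 2

set_option maxHeartbeats 2000000 in
def fam_279_67a_30b : SymbolicMorphism where
  lo := 10 / 9
  loIncluded := False
  hi := 29 / 26
  excluded := [39 / 35]
  s := 67
  t := 30
  c := 5
  e := 4
  nonzeroLetters := 279
  blocks := [(-7, 8, 1), (10, -11, 1), (10, -11, 1), (1, -1, 1), (-26, 29, 1), (28, -31, 1),
    (2, -2, 1), (1, -1, 1), (-25, 28, 1), (10, -11, 1), (2, -2, 1), (1, -1, 1), (10, -11, 1),
    (3, -3, 1), (-25, 28, 1), (10, -11, 1), (3, -3, 1), (10, -11, 1), (-8, 9, 1), (1, -1, 1),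
    (10, -11, 1), (-25, 28, 1), (10, -11, 1), (-8, 9, 1), (1, -1, 1), (10, -11, 1), (2, -2, 2),
    (1, -1, 1), (10, -11, 1), (-25, 28, 1), (2, -2, 2), (1, -1, 1), (10, -11, 1), (3, -3, 1),
    (10, -11, 1), (-25, 28, 1), (3, -3, 1), (10, -11, 1), (1, -1, 1), (1, -1, 2), (1, -1, 1),
    (10, -11, 1), (-25, 28, 1), (1, -1, 1), (1, -1, 2), (1, -1, 1), (2, -2, 1), (11, -12, 1),
    (10, -11, 1), (2, -2, 1), (-24, 27, 1), (2, -2, 1), (1, -1, 1), (10, -11, 1), (10, -11, 1),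
    (2, -2, 1), (1, -1, 1), (-25, 28, 1), (27, -30, 1), (-24, 27, 1), (10, -11, 1), (10, -11, 1),
    (-8, 9, 1), (11, -12, 1), (2, -2, 1), (1, -1, 1), (-25, 28, 1), (10, -11, 1), (2, -2, 1),
    (1, -1, 1), (10, -11, 1), (-25, 28, 1), (28, -31, 1), (-25, 28, 1), (10, -11, 1),
    (10, -11, 1), (-7, 8, 1), (10, -11, 1), (-8, 9, 1), (1, -1, 1), (10, -11, 1), (-25, 28, 1),
    (10, -11, 1), (-8, 9, 1), (1, -1, 1), (10, -11, 1), (3, -3, 1), (10, -11, 1), (-25, 28, 1),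
    (3, -3, 1), (10, -11, 1), (1, -1, 1), (9, -10, 1), (-7, 8, 1), (10, -11, 1), (-25, 28, 1),
    (1, -1, 1), (9, -10, 1), (-7, 8, 1), (2, -2, 1), (1, -1, 1), (10, -11, 1), (10, -11, 1),
    (2, -2, 1), (1, -1, 1), (-25, 28, 1), (3, -3, 1), (10, -11, 1), (10, -11, 1), (3, -3, 1),
    (-25, 28, 1), (27, -30, 1), (1, -1, 1), (-25, 28, 1), (10, -11, 1), (10, -11, 1), (-8, 9, 1),
    (1, -1, 1), (10, -11, 1), (2, -2, 2), (1, -1, 1), (-25, 28, 1), (10, -11, 1), (2, -2, 2),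
    (1, -1, 1), (10, -11, 1), (3, -3, 1), (-25, 28, 1), (10, -11, 1), (3, -3, 1), (10, -11, 1),
    (1, -1, 1), (1, -1, 2), (1, -1, 1), (-25, 28, 1), (10, -11, 1), (1, -1, 1), (1, -1, 2),
    (1, -1, 1), (2, -2, 1), (11, -12, 1), (-25, 28, 1), (2, -2, 1), (11, -12, 1), (2, -2, 1),
    (1, -1, 1), (10, -11, 1), (-25, 28, 1), (2, -2, 1), (1, -1, 1), (10, -11, 1), (-8, 9, 1),
    (11, -12, 1), (10, -11, 1), (-25, 28, 1), (27, -30, 1), (-24, 27, 1), (2, -2, 1), (1, -1, 1),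
    (10, -11, 1), (10, -11, 1), (2, -2, 1), (1, -1, 1), (-25, 28, 1), (10, -11, 1), (-7, 8, 1),
    (10, -11, 1), (10, -11, 1), (-25, 28, 1), (28, -31, 1), (-25, 28, 1), (27, -30, 1),
    (1, -1, 1), (-25, 28, 1), (10, -11, 1), (10, -11, 1), (-8, 9, 1), (1, -1, 1), (10, -11, 1),
    (3, -3, 1), (-25, 28, 1), (10, -11, 1), (3, -3, 1), (10, -11, 1), (1, -1, 1), (-26, 29, 1),
    (28, -31, 1), (-25, 28, 1), (10, -11, 1), (1, -1, 1), (9, -10, 1), (-7, 8, 1), (2, -2, 1),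
    (1, -1, 1), (10, -11, 1), (-25, 28, 1), (2, -2, 1), (1, -1, 1), (10, -11, 1), (3, -3, 1),
    (10, -11, 1), (-25, 28, 1), (3, -3, 1), (10, -11, 1), (-8, 9, 1), (1, -1, 1), (10, -11, 1),
    (10, -11, 1), (-25, 28, 1), (27, -30, 1), (1, -1, 1), (-25, 28, 1), (2, -2, 2), (1, -1, 1),
    (10, -11, 1), (10, -11, 1), (2, -2, 2), (1, -1, 1), (-25, 28, 1), (3, -3, 1), (10, -11, 1),
    (10, -11, 1), (3, -3, 1), (-25, 28, 1), (1, -1, 1), (1, -1, 2), (1, -1, 1), (10, -11, 1),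
    (10, -11, 1), (1, -1, 1), (1, -1, 2), (1, -1, 1), (2, -2, 1), (-24, 27, 1), (10, -11, 1),
    (2, -2, 1), (11, -12, 1), (2, -2, 1), (1, -1, 1), (-25, 28, 1), (10, -11, 1), (2, -2, 1),
    (1, -1, 1), (10, -11, 1), (-8, 9, 1), (11, -12, 1), (-25, 28, 1), (10, -11, 1), (-8, 9, 1),
    (11, -12, 1), (2, -2, 1), (1, -1, 1), (10, -11, 1), (-25, 28, 1), (2, -2, 1), (1, -1, 1),
    (10, -11, 1), (10, -11, 1), (-7, 8, 1), (10, -11, 1), (-25, 28, 1), (10, -11, 1), (-7, 8, 1),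
    (10, -11, 1), (-8, 9, 1), (1, -1, 1), (10, -11, 1), (10, -11, 1), (-25, 28, 1), (27, -30, 1),
    (1, -1, 1), (-25, 28, 1), (3, -3, 1), (10, -11, 1), (10, -11, 1), (3, -3, 1), (-25, 28, 1),
    (1, -1, 1)]
  last := (9, -10)
  d := 1

/-- The thirty symbolic morphisms. -/
def symbolicMorphisms : List SymbolicMorphism :=
  [fam_2_2a_b, fam_3_a, fam_4_5a_4b, fam_4_a, fam_6_4a_2b_I, fam_6_4a_2b_II, fam_8_5a_3b,
   fam_10_11a_10b, fam_12_7a_5b, fam_13_7a_4b, fam_14_8a_4b, fam_14_6a_b_I, fam_14_6a_b_II,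
   fam_16_9a_7b, fam_18_10a_8b, fam_20_11a_9b, fam_24_13a_11b, fam_26_9a_4b, fam_29_14a_9b,
   fam_30_10a_5b, fam_37_24a_15b, fam_38_12a_7b, fam_42_13a_8b, fam_46_14a_9b_I,
   fam_46_14a_9b_II, fam_54_13a_5b, fam_102_38a_15b, fam_158_53a_30b, fam_191_66a_28b,
   fam_279_67a_30b]

/-! In every item 1 < a/b < 2, so an a/b-power is a word of length m a whose first m (a - b) letters
agree with those m b places later. Suppose that φ(w) contains such a factor, and let l be the
locating length. If m (a - b) ≥ l, a word of length l occurs at two positions m b apart, so locating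
gives k ∣ m b. As k = s a - t b is coprime to b, k ∣ m. The last letter of φ(n) is n + d, so reading
only the last letters of the images inside the factor yields an a/b-power in w. If m (a - b) < l,
then m < M for a constant M with l ≤ M (a - b), and these finitely many m are excluded whatever w
is. This reduction is `DescribedBy.isPowerFreeMorphism`.

Both remaining claims, locating and the absence of short powers, concern one k-periodic sequence.
Each letter of φ(w) is replaced by a code: a fixed letter by its value plus one, the variable last
letter by 0, of which only the lower bound d ≥ 1 is remembered. Two codes are compatible if some
letter fits both. A nonzero letter never matches a zero, so two stretches of the sequence can be
compared gap by gap, a gap being a run of zeros with the nonzero letter that ends it. `walk_sound`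
treats short powers by following the sequence and its shift by m b and bounding the distance between
successive mismatches; `locate_sound` treats locating by comparing the stretches that follow any two
gaps.

Gap lengths are linear forms i a + j b. For a/b strictly between p/q and p'/q', the vector (a, b) is
a positive combination of (p, q) and (p', q'). A form is then represented by the pair of its values
at the two ends, and a componentwise inequality of pairs proves the inequality for all a/b in the
cell. An interval is cut at finitely many breakpoints until all comparisons needed are decided; the
breakpoints themselves are checked singly or are exempt. Thus each item becomes one finite
computation, performed by the kernel and interpreted by `Range.check_sound` and `fullCheck_sound`.
-/

/-! ### Fractional powers with exponent between 1 and 2. -/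

theorem fractionalPower_eq {α : Type*} {a b m : ℕ} (hb : b < a) (hab : a < 2 * b) (v : List α)
    (hv : v.length = m * b) : fractionalPower v a b = v ++ v.take (m * (a - b)) := by
  have h1 : a / b = 1 := Nat.div_eq_of_lt_le (by omega) (by omega)
  have h2 : a % b = a - b := by
    have := Nat.mod_add_div a b
    rw [h1] at this
    omega
  have h3 : v.length * (a % b) / b = m * (a - b) := by
    rw [hv, h2, mul_right_comm]
    exact Nat.mul_div_cancel _ (by omega)
  simp [fractionalPower, h1, h3]

/-- Here v is the prefix of length m b, and the remaining m (a - b) ≤ m b letters repeat its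
beginning. This form is stable under taking every k-th letter, which is how powers are pulled back.
-/
theorem isFractionalPower_iff {α : Type*} {a b : ℕ} (hb : b < a) (hab : a < 2 * b) (x : List α) :
    IsFractionalPower a b x ↔
      ∃ m, 0 < m ∧ x.length = m * a ∧ ∀ t < m * (a - b), x[t]? = x[t + m * b]? := by
  have hsum (m : ℕ) : m * b + m * (a - b) = m * a := by
    rw [← mul_add]
    congr 1
    omega
  have hle (m : ℕ) : m * (a - b) ≤ m * b := Nat.mul_le_mul_left m (by omega)
  constructor
  · rintro ⟨v, hv, ⟨m, hm⟩, rfl⟩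
    rw [mul_comm] at hm
    have hm0 : 0 < m := by
      rcases Nat.eq_zero_or_pos m with rfl | h
      · simp at hm
        exact absurd hm hv
      · exact h
    refine ⟨m, hm0, ?_, ?_⟩
    · rw [fractionalPower_eq hb hab v hm]
      simp only [List.length_append, List.length_take, hm]
      rw [min_eq_left (hle m), hsum]
    · intro t ht
      have := hle m
      rw [fractionalPower_eq hb hab v hm, List.getElem?_append_left (by omega),
        List.getElem?_append_right (by omega), hm, Nat.add_sub_cancel,
        List.getElem?_take_of_lt ht]
  · rintro ⟨m, hm, hx, h⟩
    have hlen : (x.take (m * b)).length = m * b := by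
      rw [List.length_take, hx, min_eq_left]
      have := hsum m
      omega
    refine ⟨x.take (m * b), ?_, ⟨m, by rw [hlen, mul_comm]⟩, ?_⟩
    · intro h0
      rw [h0] at hlen
      have : 0 < m * b := Nat.mul_pos hm (by omega)
      simp at hlen
      omega
    · rw [fractionalPower_eq hb hab _ hlen]
      apply List.ext_getElem?
      intro t
      have h2 := hle m
      have h3 := hsum m
      rcases lt_or_ge t (m * b) with ht | ht
      · rw [List.getElem?_append_left (by omega), List.getElem?_take_of_lt ht]
      · rw [List.getElem?_append_right (by omega), hlen]
        rcases lt_or_ge (t - m * b) (m * (a - b)) with ht2 | ht2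
        · rw [List.getElem?_take_of_lt ht2, List.getElem?_take_of_lt (by omega), h _ ht2,
            Nat.sub_add_cancel ht]
        · rw [List.getElem?_eq_none (by omega), List.getElem?_eq_none]
          rw [List.length_take]
          omega

/-! ### Images under uniform morphisms, codes of letters, and the reduction to a periodic sequence.
-/

theorem length_applyMorphism {α : Type*} {k : ℕ} {φ : α → List α} (hφ : IsUniformMorphism k φ)
    (w : List α) : (applyMorphism φ w).length = w.length * k := by
  induction w with
  | nil => simp [applyMorphism]
  | cons n w ih =>
    simp only [applyMorphism, List.flatMap_cons, List.length_append, List.length_cons] at ih ⊢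
    rw [ih, hφ n]
    ring

theorem getElem?_applyMorphism {α : Type*} {k : ℕ} {φ : α → List α} (hφ : IsUniformMorphism k φ)
    {r : ℕ} (hr : r < k) (w : List α) (i : ℕ) :
    (applyMorphism φ w)[i * k + r]? = w[i]?.bind fun n => (φ n)[r]? := by
  induction w generalizing i with
  | nil => simp [applyMorphism]
  | cons n w ih =>
    have hn := hφ n
    cases i with
    | zero =>
      simp only [applyMorphism, List.flatMap_cons]
      rw [List.getElem?_append_left (by omega)]
      simp
    | succ i =>
      have h := ih i
      simp only [applyMorphism, List.flatMap_cons] at h ⊢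
      rw [List.getElem?_append_right (by rw [hn, add_mul]; omega), hn,
        show (i + 1) * k + r - k = i * k + r by rw [add_mul]; omega, h]
      simp

/-- The code `c` describes the letter `y`: it is `y + 1`, or it is `0` and `d ≤ y`. -/
def Describes (d c y : ℕ) : Prop := c = 0 ∧ d ≤ y ∨ c = y + 1

/-- Letters described by `c` and `c'` can be equal. -/
def Compatible (d c c' : ℕ) : Prop := ∃ y, Describes d c y ∧ Describes d c' y

/-- The morphism `φ` is `k`-uniform, its images are described by the `k`-periodic sequence `S`,
and the last letter of `φ(n)` is `n + d`. -/
structure DescribedBy (d k : ℕ) (φ : ℕ → List ℕ) (S : ℕ → ℕ) : Prop where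
  pos : 0 < k
  uniform : IsUniformMorphism k φ
  last : ∀ n, (φ n)[k - 1]? = some (n + d)
  describes : ∀ n r y, (φ n)[r]? = some y → Describes d (S r) y
  periodic : ∀ i r, S (i * k + r) = S r

namespace DescribedBy

variable {d k : ℕ} {φ : ℕ → List ℕ} {S : ℕ → ℕ}

theorem describes_applyMorphism (h : DescribedBy d k φ S) {w : List ℕ} {q y : ℕ}
    (hq : (applyMorphism φ w)[q]? = some y) : Describes d (S q) y := by
  have hr := Nat.mod_lt q h.pos
  rw [← Nat.div_add_mod' q k, getElem?_applyMorphism h.uniform hr] at hq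
  obtain ⟨n, -, hn⟩ := Option.bind_eq_some_iff.1 hq
  have := h.describes n _ _ hn
  rwa [← h.periodic (q / k), Nat.div_add_mod'] at this

theorem getElem?_last (h : DescribedBy d k φ S) (w : List ℕ) (i : ℕ) :
    (applyMorphism φ w)[i * k + (k - 1)]? = w[i]?.map (· + d) := by
  have := h.pos
  rw [getElem?_applyMorphism h.uniform (by omega)]
  simp only [h.last]
  cases w[i]? <;> rfl

/-- Two occurrences of x put codes of the same letters at both places, hence compatible codes. A
word that never occurs is located by any j. The first hypothesis available in `hS` keeps the letters
of x themselves; it serves for words that may lie in a run of zeros. -/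
theorem locatesWord {l : ℕ} (h : DescribedBy d k φ S) (x : List ℕ) (hx : x.length = l)
    (hS : ∀ p p', (∀ t, ∀ y, x[t]? = some y → Describes d (S (p + t)) y) →
      (∀ t < l, Compatible d (S (p + t)) (S (p' + t))) → p ≡ p' [MOD k]) :
    LocatesWord k φ x := by
  by_cases H : ∃ w p q, applyMorphism φ w = p ++ x ++ q
  · obtain ⟨w, p, q, hw⟩ := H
    refine ⟨p.length, fun w' p' q' hw' => ?_⟩
    have key : ∀ {w p q : List ℕ}, applyMorphism φ w = p ++ x ++ q →
        ∀ t y, x[t]? = some y → Describes d (S (p.length + t)) y := by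
      intro w p q hw t y hy
      apply h.describes_applyMorphism (w := w)
      have ht := (List.getElem?_eq_some_iff.1 hy).1
      rw [hw, List.append_assoc, List.getElem?_append_right (by omega), Nat.add_sub_cancel_left,
        List.getElem?_append_left ht, hy]
    refine hS _ _ (key hw') fun t ht => ?_
    have hy : x[t]? = some x[t] := List.getElem?_eq_getElem (by omega)
    exact ⟨_, key hw' t _ hy, key hw t _ hy⟩
  · push Not at H
    exact ⟨0, fun w p q hw => absurd hw (H w p q)⟩

/-- Short powers are excluded by `hshort`. In a long one the repetition at distance m b is
synchronized with the blocks of φ by `hloc`, so its period is a multiple of k and it descends to w.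
-/
theorem isPowerFreeMorphism {a b l : ℕ} (hb : b < a) (hab : a < 2 * b) (hcop : Nat.Coprime b k)
    (h : DescribedBy d k φ S)
    (hshort : ∀ m, 0 < m → m * (a - b) < l →
      ∀ p, ∃ t < m * (a - b), ¬ Compatible d (S (p + t)) (S (p + t + m * b)))
    (hloc : ∀ p p', (∀ t < l, Compatible d (S (p + t)) (S (p' + t))) → p ≡ p' [MOD k]) :
    IsPowerFreeMorphism a b φ := by
  rintro w hw x ⟨p, q, hx⟩ hpow
  obtain ⟨m, hm, hlen, heq⟩ := (isFractionalPower_iff hb hab x).1 hpow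
  have hsum (m : ℕ) : m * b + m * (a - b) = m * a := by
    rw [← mul_add]
    congr 1
    omega
  have hget : ∀ t < x.length, (applyMorphism φ w)[p.length + t]? = x[t]? := by
    intro t ht
    rw [← hx, List.append_assoc, List.getElem?_append_right (by omega), Nat.add_sub_cancel_left,
      List.getElem?_append_left ht]
  have hequal : ∀ t < m * (a - b), (applyMorphism φ w)[p.length + t]? =
      (applyMorphism φ w)[p.length + t + m * b]? := by
    intro t ht
    have := hsum m
    rw [add_assoc, hget t (by omega), hget _ (by omega), heq t ht]
  have hcompat : ∀ t < m * (a - b),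
      Compatible d (S (p.length + t)) (S (p.length + t + m * b)) := by
    intro t ht
    have := hsum m
    have h1 := hget t (by omega)
    rw [List.getElem?_eq_getElem (l := x) (i := t) (by omega)] at h1
    have h2 := h1
    rw [hequal t ht] at h2
    exact ⟨_, h.describes_applyMorphism h1, h.describes_applyMorphism h2⟩
  rcases lt_or_ge (m * (a - b)) l with hl | hl
  · obtain ⟨t, ht, hn⟩ := hshort m hm hl p.length
    exact hn (hcompat t ht)
  -- The first l letters of the power recur m b places later.
  have hmod : p.length ≡ p.length + m * b [MOD k] := by
    refine hloc _ _ fun t ht => ?_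
    have := hcompat t (by omega)
    rwa [add_right_comm] at this
  have hdvd : k ∣ m := by
    have h1 : k ∣ m * b := by
      have := (Nat.modEq_iff_dvd' (by omega)).1 hmod
      rwa [Nat.add_sub_cancel_left] at this
    exact hcop.symm.dvd_of_dvd_mul_right h1
  obtain ⟨m', rfl⟩ := hdvd
  have hk := h.pos
  have hm' : 0 < m' := Nat.pos_of_mul_pos_left hm
  have htot : p.length + k * m' * a ≤ w.length * k := by
    rw [← length_applyMorphism h.uniform, ← hx, ← hlen]
    simp only [List.length_append]
    omega
  set j := p.length / k with hj
  set r := p.length % k with hr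
  have hrk : r < k := Nat.mod_lt _ hk
  have hp : p.length = j * k + r := (Nat.div_add_mod' _ _).symm
  have hjw : j + m' * a ≤ w.length := by
    by_contra! hlt
    have : (w.length + 1) * k ≤ (j + m' * a) * k := Nat.mul_le_mul_right k hlt
    have e : (j + m' * a) * k = j * k + k * m' * a := by ring
    rw [e, add_mul] at this
    omega
  -- The power in w starts at the letter whose image contains position p. Even if p is inside that
  -- image, its last letter still belongs to the power.
  refine hw ((w.drop j).take (m' * a))
    ((List.take_prefix _ _).isInfix.trans (List.drop_suffix _ _).isInfix)
    ((isFractionalPower_iff hb hab _).2 ⟨m', hm', ?_, fun t ht => ?_⟩)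
  · rw [List.length_take, List.length_drop]
    omega
  · have hs := hsum m'
    rw [List.getElem?_take_of_lt (by omega), List.getElem?_take_of_lt (by omega),
      List.getElem?_drop, List.getElem?_drop]
    -- With p = j k + r, the offset t k + (k - 1 - r) leads to the last letter of the image of the
    -- letter number j + t of w.
    have ht2 : t * k + (k - 1 - r) < k * m' * (a - b) := by
      have : (t + 1) * k ≤ m' * (a - b) * k := Nat.mul_le_mul_right k ht
      have e : k * m' * (a - b) = m' * (a - b) * k := by ring
      rw [e]
      rw [add_mul] at this
      omega
    have := hequal _ ht2
    rw [show p.length + (t * k + (k - 1 - r)) = (j + t) * k + (k - 1) by rw [hp, add_mul]; omega,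
      show (j + t) * k + (k - 1) + k * m' * b = (j + (t + m' * b)) * k + (k - 1) by ring,
      h.getElem?_last, h.getElem?_last] at this
    rw [List.getElem?_eq_getElem (by omega), List.getElem?_eq_getElem (by omega)] at this ⊢
    simpa using this

end DescribedBy

/-! ### The checks, as functions that the kernel can evaluate. -/

/-- The linear form `u λ + v μ` in place of a run of zeros and the nonzero letter that ends it,
the letter being given by its code `c`: `0` for the last letter of `φ(n)`, `x + 1` for `x`. -/
structure GapCode where
  u : ℕ
  v : ℕ
  c : ℕ

namespace GapCode

/-- The tests are built on `Nat.beq` and `Nat.ble`, and the walks on explicit recursors, so that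
they reduce well in the kernel. -/
def pairEq (u v u' v' : ℕ) : Bool :=
  Bool.rec false (Nat.beq v v') (Nat.beq u u')

/-- A sufficient condition only: pairs that are not comparable componentwise leave the order of the
numbers undecided. The checks then fail, and the cell has to be subdivided. -/
def pairLe (u v u' v' : ℕ) : Bool :=
  Bool.rec false (Nat.ble v v') (Nat.ble u u')

/-- Whether letters with codes `c` and `c'` can be equal. -/
def compat (d c c' : ℕ) : Bool :=
  Bool.rec
    (or (and (Nat.beq c 0) (Nat.ble (d + 1) c')) (and (Nat.beq c' 0) (Nat.ble (d + 1) c)))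
    true (Nat.beq c c')

/-- The step of `walk` for nonempty streams. -/
noncomputable def walkStep (d Lu Lv : ℕ) (ih : ℕ → ℕ → List GapCode → List GapCode → Bool)
    (cu cv xu xv xc : ℕ) (xs : List GapCode) (yu yv yc : ℕ) (ys : List GapCode) : Bool :=
  Bool.rec
    (Bool.rec
      (Bool.rec false
        (Bool.rec false (ih 0 0 (⟨xu - yu, xv - yv, xc⟩ :: xs) ys)
          (pairLe (cu + yu) (cv + yv) Lu Lv))
        (pairLe yu yv xu xv))
      (Bool.rec false (ih 0 0 xs (⟨yu - xu, yv - xv, yc⟩ :: ys))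
        (pairLe (cu + xu) (cv + xv) Lu Lv))
      (pairLe xu xv yu yv))
    (Bool.rec
      (Bool.rec false (ih 0 0 xs ys) (pairLe (cu + xu) (cv + xv) Lu Lv))
      (ih (cu + xu) (cv + xv) xs ys)
      (compat d xc yc))
    (pairEq xu xv yu yv)

/-- Reads two streams in parallel and checks that consecutive mismatches are at distance at
most `L`; the last mismatch was `c` letters ago. -/
noncomputable def walk (d Lu Lv n : ℕ) : ℕ → ℕ → List GapCode → List GapCode → Bool :=
  Nat.rec (fun _ _ _ _ => false)
    (fun _ ih cu cv xs ys =>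
      List.rec (and (pairLe cu cv Lu Lv) (not (pairEq cu cv Lu Lv)))
        (fun x xs _ => List.rec false
          (fun y ys _ => walkStep d Lu Lv ih cu cv x.u x.v x.c xs y.u y.v y.c ys) ys) xs) n

/-- The stream that is left after the first `s` letters. -/
noncomputable def skip (l : List GapCode) : ℕ → ℕ → List GapCode :=
  List.rec (fun _ _ => [])
    (fun g gs ih su sv =>
      Bool.rec (Bool.rec [] (⟨g.u - su, g.v - sv, g.c⟩ :: gs) (pairLe su sv g.u g.v))
        (ih (su - g.u) (sv - g.v)) (pairLe g.u g.v su sv)) l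

/-- Reads two streams in parallel up to the first mismatch and checks that it comes early enough
for words of length `l`, of which `c` letters have been read. -/
noncomputable def pairWalk (d lu lv : ℕ) (l : List GapCode) : ℕ → ℕ → List GapCode → Bool :=
  List.rec (fun _ _ _ => false)
    (fun x _ ih cu cv ys => List.rec false
      (fun y ys _ =>
        Bool.rec
          (Bool.rec
            (Bool.rec false (pairLe (cu + y.u) (cv + y.v) lu lv) (pairLe y.u y.v x.u x.v))
            (pairLe (cu + x.u) (cv + x.v) lu lv)
            (pairLe x.u x.v y.u y.v))
          (Bool.rec (pairLe (cu + x.u) (cv + x.v) lu lv) (ih (cu + x.u) (cv + x.v) ys)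
            (compat d x.c y.c))
          (pairEq x.u x.v y.u y.v)) ys) l

/-- An occurrence of a gap, with the gaps that follow and a key that depends on finitely many
of these. -/
structure Item where
  key : ℕ
  head : GapCode
  tail : List GapCode

/-- Checks that no factor of length `l` occurs with its first nonzero letter at both items. -/
noncomputable def pairStart (d lu lv : ℕ) (x y : Item) : Bool :=
  Bool.rec true
    (Bool.rec
      (Bool.rec false (pairWalk d lu lv x.tail y.head.u y.head.v y.tail)
        (pairLe y.head.u y.head.v x.head.u x.head.v))
      (pairWalk d lu lv x.tail x.head.u x.head.v y.tail)
      (pairLe x.head.u x.head.v y.head.u y.head.v))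
    (compat d x.head.c y.head.c)

noncomputable def pairsAt (d lu lv : ℕ) (x : Item) (l : List Item) : Bool :=
  List.rec true
    (fun y _ ih => Bool.rec ih (and (pairStart d lu lv x y) ih) (Nat.beq x.key y.key)) l

noncomputable def pairs (d lu lv : ℕ) (l : List Item) : Bool :=
  List.rec true (fun x xs ih => and (pairsAt d lu lv x xs) ih) l

/-- Evaluates `n` before applying `K`. -/
noncomputable def force (n : ℕ) (K : ℕ → Bool) : Bool :=
  Nat.rec (K 0) (fun m _ => K m) (n + 1)

/-- A number that depends on the first `r` gaps only. -/
def key : ℕ → List GapCode → ℕ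
  | 0, _ => 0
  | _ + 1, [] => 0
  | r + 1, x :: xs => x.u + 2 ^ 16 * x.v + 2 ^ 32 * key r xs

/-- Applies `K` to the first `n` items of a list of gaps, in reverse order. -/
noncomputable def withItems (r : ℕ) (K : List Item → Bool) :
    ℕ → List GapCode → List Item → Bool
  | 0, _, acc => K acc
  | _ + 1, [], _ => false
  | n + 1, x :: xs, acc => force (key r xs) fun k => withItems r K n xs (⟨k, x, xs⟩ :: acc)

/-- `i p + j q`. -/
def lin (p q : ℕ) (i j : ℤ) : ℤ := i * p + j * q

/-- Applies `K` to the values of `i p + j q` at both ends of a cell, if these are nonnegative. -/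
noncomputable def withLin (p q p' q' : ℕ) (i j : ℤ) (K : ℕ → ℕ → Bool) : Bool :=
  and (decide (0 ≤ lin p q i j)) (and (decide (0 ≤ lin p' q' i j))
    (force (lin p q i j).toNat fun u => force (lin p' q' i j).toNat fun v => K u v))

/-- Applies `K` to the coded gaps, if these are positive. -/
noncomputable def withGaps (p q p' q' : ℕ) (K : List GapCode → Bool) :
    List (ℤ × ℤ × ℕ) → List GapCode → Bool
  | [], acc => K acc
  | r :: l, acc => withLin p q p' q' r.1 r.2.1 fun u v =>
      and (Nat.ble 1 (u + v)) (withGaps p q p' q' K l (⟨u, v, r.2.2⟩ :: acc))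

/-- The blocks of `φ(n)`, with codes in place of letters. -/
def codedBlocks (F : SymbolicMorphism) : List (ℤ × ℤ × ℕ) :=
  F.blocks.map (fun r => (r.1, r.2.1, r.2.2 + 1)) ++ [(F.last.1, F.last.2, 0)]

/-- Checks that `φ(w)` contains no `a/b`-power of length `m a` with `m (a - b)` less than the
locating length. -/
noncomputable def shortCheck (F : SymbolicMorphism) (m p q p' q' : ℕ) : Bool :=
  withGaps p q p' q' (fun G =>
    withLin p q p' q' m (-m) fun Lu Lv =>
    withLin p q p' q' F.s (-F.t) fun ku kv =>
    withLin p q p' q' F.c (-F.e) fun lu lv =>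
    -- Powers with m (a - b) ≥ l need no check. Otherwise m (a - b) ≤ k makes every window that
    -- starts in the first period end within the second, so two copies of the gaps suffice.
    or (pairLe lu lv Lu Lv) (and (pairLe Lu Lv ku kv)
      -- The fuel allows for one step per gap of either stream. All items have s > t, so b ≤ k and m
      -- + 3 periods outlast a shift by m b followed by two periods. Too little fuel or too short a
      -- second stream can only make the check fail.
      (walk F.d Lu Lv (4 * F.nonzeroLetters + 8) 0 0 (G ++ G)
        (skip (List.replicate (m + 3) G).flatten (m * q) (m * q')))))
    (codedBlocks F).reverse []

/-- The gaps without repetitions. -/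
def types (G : List GapCode) : List GapCode :=
  G.foldr (fun g T => bif T.any (fun h => pairEq g.u g.v h.u h.v) then T else g :: T) []

/-- Checks that items with different keys need not be compared. -/
noncomputable def keyCheck (G : List GapCode) (lu lv : ℕ) : ℕ → Bool
  | 0 => true
  | r + 1 => and (Nat.ble (r + 1) G.length)
      ((types G).all fun x => and (pairLe ((r + 2) * x.u) ((r + 2) * x.v) lu lv)
        ((types G).all fun y => or (pairLe x.u x.v y.u y.v) (pairLe y.u y.v x.u x.v)))

/-- Checks that words of length `c a - e b` with a nonzero letter are located. -/
noncomputable def locateCheck (F : SymbolicMorphism) (c e : ℤ) (r p q p' q' : ℕ) : Bool :=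
  withGaps p q p' q' (fun G =>
    withLin p q p' q' c (-e) fun lu lv =>
    and (keyCheck G lu lv r)
      (withItems r (pairs F.d lu lv) G.length (G ++ G) [])) (codedBlocks F).reverse []

/-- Checks that the locating length `l` satisfies `1 ≤ l ≤ M (a - b)` and that words of this
length contain a nonzero letter. -/
noncomputable def lengthCheck (F : SymbolicMorphism) (M p q p' q' : ℕ) : Bool :=
  withGaps p q p' q' (fun G =>
    withLin p q p' q' F.c (-F.e) fun lu lv =>
    withLin p q p' q' M (-M) fun Lu Lv =>
    and (Nat.ble 1 (lu + lv)) (and (pairLe lu lv Lu Lv)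
      (G.all fun x => pairLe x.u x.v lu lv))) (codedBlocks F).reverse []

/-- Whether `a / b = x / y` is excluded. -/
def exempt (ex : List (ℕ × ℕ)) (s x y : ℕ) : Bool :=
  or (ex.any fun e => and (Nat.ble 1 e.2) (Nat.beq (e.1 * y) (x * e.2)))
    (and (Nat.beq (Nat.gcd x y) 1) (not (Nat.beq (Nat.gcd y s) 1)))

/-- For a/b = x/y a form is represented by its value at (x, y), with second component 0. -/
def pointCheck (f : ℕ → ℕ → ℕ → ℕ → Bool) (ex : List (ℕ × ℕ)) (s x y : ℕ) : Bool :=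
  and (Nat.ble 1 y) (or (exempt ex s x y) (f x y 0 0))

/-- Checks `f` on the cell between `p / q` and `p' / q'`, if necessary after a subdivision. -/
def refine (f : ℕ → ℕ → ℕ → ℕ → Bool) (ex : List (ℕ × ℕ)) (s : ℕ) :
    ℕ → ℕ → ℕ → ℕ → List (ℕ × ℕ) → Bool
  | p, q, p', q', [] => f p q p' q'
  | p, q, p', q', z :: l => or (f p q p' q')
      (bif and (Nat.ble (p * z.2 + 1) (z.1 * q)) (Nat.ble (z.1 * q' + 1) (p' * z.2)) then
        and (refine f ex s p q z.1 z.2 l) (and (pointCheck f ex s z.1 z.2)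
          (refine f ex s z.1 z.2 p' q' l))
      else refine f ex s p q p' q' l)

/-- The interval of values of `a / b`, and the excluded values. -/
structure Range where
  lo : ℕ × ℕ
  hi : ℕ × ℕ
  incl : Bool
  ex : List (ℕ × ℕ)

/-- The last two tests give 1 < a/b < 2 on the whole range. -/
def Range.wellFormed (I : Range) : Bool :=
  and (Nat.ble 1 I.lo.2) (and (Nat.ble 1 I.hi.2)
    (and (Nat.ble (I.lo.2 + 1) I.lo.1) (Nat.ble I.hi.1 (2 * I.hi.2))))

/-- Checks `f` for all admissible values of `a / b`. -/
def Range.check (I : Range) (s : ℕ) (f : ℕ → ℕ → ℕ → ℕ → Bool) (l : List (ℕ × ℕ)) : Bool :=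
  and (or (not I.incl) (pointCheck f I.ex s I.lo.1 I.lo.2))
    (refine f I.ex s I.lo.1 I.lo.2 I.hi.1 I.hi.2 l)

noncomputable def shortChecks (F : SymbolicMorphism) (I : Range) (l : List (ℕ × ℕ)) : ℕ → Bool
  | 0 => true
  | m + 1 => and (I.check F.s (shortCheck F (m + 1)) l) (shortChecks F I l m)

/-- The two sums are the coefficients of the total length k = s a - t b. The bound d ≥ 1 keeps the
variable last letter distinct from 0. -/
def staticCheck (F : SymbolicMorphism) : Bool :=
  and (Nat.ble 1 F.d) (and (Nat.beq F.nonzeroLetters (F.blocks.length + 1))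
    (and (Nat.ble 2 F.nonzeroLetters) (and (F.blocks.all fun r => Nat.ble 1 r.2.2)
      (and (decide ((F.blocks.map fun r => r.1).sum + F.last.1 = F.s))
        (decide ((F.blocks.map fun r => r.2.1).sum + F.last.2 = -F.t))))))

/-- The complete check of `F`, with breakpoints `l` for the short powers and `l'` for locating. -/
noncomputable def fullCheck (F : SymbolicMorphism) (I : Range) (M r : ℕ) (l l' : List (ℕ × ℕ)) :
    Bool :=
  and (and I.wellFormed (staticCheck F)) (and (I.check F.s (lengthCheck F M) l')
    (and (I.check F.s (locateCheck F F.c F.e r) l') (shortChecks F I l (M - 1))))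

end GapCode

/-! ### Numbers represented by pairs. -/

/-- A triple of positive integers: the pair `(u, v)` stands for the number `(s u + t v) / D`. -/
structure Scale where
  D : ℕ
  s : ℕ
  t : ℕ
  D_pos : 0 < D
  s_pos : 0 < s
  t_pos : 0 < t

namespace Scale

variable {σ : Scale} {u v n u' v' n' : ℕ}

/-- The pair `(u, v)` represents the number `n`. -/
def Rep (σ : Scale) (u v n : ℕ) : Prop := σ.D * n = σ.s * u + σ.t * v

theorem Rep.zero (σ : Scale) : σ.Rep 0 0 0 := by simp [Rep]

theorem Rep.add (h : σ.Rep u v n) (h' : σ.Rep u' v' n') : σ.Rep (u + u') (v + v') (n + n') := by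
  unfold Rep at *
  rw [mul_add, h, h']
  ring

theorem Rep.smul (h : σ.Rep u v n) (m : ℕ) : σ.Rep (m * u) (m * v) (m * n) := by
  unfold Rep at *
  rw [mul_left_comm, h]
  ring

theorem Rep.le (h : σ.Rep u v n) (h' : σ.Rep u' v' n') (hu : u ≤ u') (hv : v ≤ v') : n ≤ n' := by
  unfold Rep at *
  refine Nat.le_of_mul_le_mul_left ?_ σ.D_pos
  rw [h, h']
  exact Nat.add_le_add (Nat.mul_le_mul_left _ hu) (Nat.mul_le_mul_left _ hv)

theorem Rep.unique (h : σ.Rep u v n) (h' : σ.Rep u v n') : n = n' :=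
  le_antisymm (h.le h' le_rfl le_rfl) (h'.le h le_rfl le_rfl)

/-- Both weights are positive, so one differing component already makes the inequality strict. -/
theorem Rep.lt (h : σ.Rep u v n) (h' : σ.Rep u' v' n') (hu : u ≤ u') (hv : v ≤ v')
    (hne : ¬ (u = u' ∧ v = v')) : n < n' := by
  unfold Rep at *
  refine Nat.lt_of_mul_lt_mul_left (a := σ.D) ?_
  rw [h, h']
  rcases hu.lt_or_eq with h1 | h1
  · exact Nat.add_lt_add_of_lt_of_le (Nat.mul_lt_mul_of_pos_left h1 σ.s_pos)
      (Nat.mul_le_mul_left _ hv)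
  · refine Nat.add_lt_add_of_le_of_lt (Nat.mul_le_mul_left _ hu)
      (Nat.mul_lt_mul_of_pos_left (lt_of_le_of_ne hv fun h2 => hne ⟨h1, h2⟩) σ.t_pos)

theorem Rep.sub (h : σ.Rep u v n) (h' : σ.Rep u' v' n') (hu : u ≤ u') (hv : v ≤ v') :
    σ.Rep (u' - u) (v' - v) (n' - n) := by
  have := h.le h' hu hv
  unfold Rep at *
  zify [hu, hv, this] at *
  linear_combination h' - h

end Scale

/-! ### Sequences read as streams of gaps. -/

/-- From position `P` on, the sequence `S` consists of the runs of zeros, each followed by a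
nonzero letter, whose total lengths and codes are listed in `l`. -/
def Reads (S : ℕ → ℕ) : ℕ → List (ℕ × ℕ) → Prop
  | _, [] => True
  | P, g :: l => 0 < g.1 ∧ g.2 ≠ 1 ∧ (∀ t, t + 1 < g.1 → S (P + t) = 1) ∧
      S (P + (g.1 - 1)) = g.2 ∧ Reads S (P + g.1) l

/-- The total length of a list of gaps. -/
def totalLength (l : List (ℕ × ℕ)) : ℕ := (l.map Prod.fst).sum

@[simp] theorem totalLength_nil : totalLength [] = 0 := rfl

@[simp] theorem totalLength_cons (g : ℕ × ℕ) (l : List (ℕ × ℕ)) :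
    totalLength (g :: l) = g.1 + totalLength l := by simp [totalLength]

@[simp] theorem totalLength_append (l l' : List (ℕ × ℕ)) :
    totalLength (l ++ l') = totalLength l + totalLength l' := by simp [totalLength]

namespace Reads

variable {S : ℕ → ℕ} {P P' : ℕ}

theorem append_iff {l l' : List (ℕ × ℕ)} :
    Reads S P (l ++ l') ↔ Reads S P l ∧ Reads S (P + totalLength l) l' := by
  induction l generalizing P with
  | nil => simp [Reads]
  | cons g l ih => simp [Reads, ih, and_assoc, add_assoc]

theorem advance {x c z : ℕ} {l : List (ℕ × ℕ)} (h : Reads S P ((x, c) :: l)) (hz : z < x) :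
    Reads S (P + z) ((x - z, c) :: l) := by
  obtain ⟨_, h1, h2, h3, h4⟩ := h
  refine ⟨Nat.sub_pos_of_lt hz, h1, fun t ht => ?_, ?_, ?_⟩
  · dsimp only at ht h2
    rw [add_assoc]
    exact h2 _ (by omega)
  · dsimp only at h3 ⊢
    rwa [show P + z + (x - z - 1) = P + (x - 1) by omega]
  · dsimp only at h4 ⊢
    rwa [show P + z + (x - z) = P + x by omega]

/-- A position falls into a unique gap, of which a final piece of length x is left. The last
equation recovers q from i and x. -/
theorem exists_suffix (l l' : List (ℕ × ℕ)) {q : ℕ} (h : Reads S P (l ++ l')) (hP : P ≤ q)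
    (hq : q < P + totalLength l) :
    ∃ (i : ℕ) (hi : i < l.length) (x : ℕ), 0 < x ∧ x ≤ l[i].1 ∧
      Reads S q ((x, l[i].2) :: (l ++ l').drop (i + 1)) ∧
      q + x = P + totalLength (l.take (i + 1)) := by
  induction l generalizing P with
  | nil => simp at hq; omega
  | cons g l ih =>
    rcases lt_or_ge q (P + g.1) with hlt | hge
    · refine ⟨0, by simp, g.1 - (q - P), by omega, by simp, ?_, by simp; omega⟩
      have := Reads.advance (z := q - P) h (by omega)
      rw [Nat.add_sub_cancel' hP] at this
      simpa using this
    · obtain ⟨i, hi, x, hx, hxi, hR, he⟩ := ih h.2.2.2.2 hge (by simp at hq; omega)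
      refine ⟨i + 1, by simpa using hi, x, hx, by simpa using hxi, by simpa using hR, ?_⟩
      simp only [List.take_succ_cons, totalLength_cons]
      omega

end Reads

/-! ### Soundness of the comparison of two streams. -/

namespace GapCode

variable {S : ℕ → ℕ} {σ : Scale} {d : ℕ}

theorem pairEq_iff {u v u' v' : ℕ} : pairEq u v u' v' = true ↔ u = u' ∧ v = v' := by
  rw [← Nat.beq_eq, ← Nat.beq_eq, pairEq]
  cases Nat.beq u u' <;> simp

theorem pairLe_iff {u v u' v' : ℕ} : pairLe u v u' v' = true ↔ u ≤ u' ∧ v ≤ v' := by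
  rw [← Nat.ble_eq, ← Nat.ble_eq, pairLe]
  cases Nat.ble u u' <;> simp

theorem compat_of_compatible {c c' : ℕ} (h : Compatible d c c') : compat d c c' = true := by
  obtain ⟨y, h1, h2⟩ := h
  unfold compat
  cases h' : Nat.beq c c'
  · have hne : c ≠ c' := fun e => by simp [e] at h'
    have : (c = 0 ∧ d + 1 ≤ c') ∨ (c' = 0 ∧ d + 1 ≤ c) := by
      unfold Describes at h1 h2
      omega
    simpa [Nat.beq_eq, Nat.ble_eq] using this
  · rfl

theorem not_compatible_one {c : ℕ} (hd : 0 < d) (hc : c ≠ 1) : ¬ Compatible d c 1 := by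
  rintro ⟨y, h1, h2⟩
  unfold Describes at h1 h2
  omega

theorem Compatible.symm {c c' : ℕ} (h : Compatible d c c') : Compatible d c' c := by
  obtain ⟨y, h1, h2⟩ := h
  exact ⟨y, h2, h1⟩

/-- The code `x` represents the gap `g`. -/
def Codes (σ : Scale) (x : GapCode) (g : ℕ × ℕ) : Prop := σ.Rep x.u x.v g.1 ∧ x.c = g.2

/-- Where the shorter gap ends in a nonzero letter, the longer one still has a zero. Because d > 0
this holds also for a variable last letter. -/
theorem mismatch_of_lt (hd : 0 < d) {P P' : ℕ} {x y : ℕ × ℕ} {xs ys : List (ℕ × ℕ)}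
    (hx : Reads S P (x :: xs)) (hy : Reads S P' (y :: ys)) (hxy : x.1 < y.1) :
    ¬ Compatible d (S (P + (x.1 - 1))) (S (P' + (x.1 - 1))) := by
  obtain ⟨h1, h2, -, h3, -⟩ := hx
  rw [h3, hy.2.2.1 _ (by omega)]
  exact not_compatible_one hd h2

theorem mismatch_of_ne (hd : 0 < d) {P P' : ℕ} {x y : ℕ × ℕ} {xs ys : List (ℕ × ℕ)}
    (hx : Reads S P (x :: xs)) (hy : Reads S P' (y :: ys)) (hxy : x.1 ≠ y.1) :
    ∃ t, t < x.1 ∧ t < y.1 ∧ ¬ Compatible d (S (P + t)) (S (P' + t)) := by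
  have h1 := hx.1
  have h2 := hy.1
  rcases hxy.lt_or_gt with h | h
  · exact ⟨_, by omega, by omega, mismatch_of_lt hd hx hy h⟩
  · exact ⟨_, by omega, by omega, fun hc => mismatch_of_lt hd hy hx h (Compatible.symm hc)⟩

theorem walk_zero {Lu Lv cu cv : ℕ} {xs ys : List GapCode} :
    walk d Lu Lv 0 cu cv xs ys = false := rfl

theorem walk_nil {Lu Lv n cu cv : ℕ} {ys : List GapCode} :
    walk d Lu Lv (n + 1) cu cv [] ys = (pairLe cu cv Lu Lv && !(pairEq cu cv Lu Lv)) := rfl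

theorem walk_cons_nil {Lu Lv n cu cv : ℕ} {x : GapCode} {xs : List GapCode} :
    walk d Lu Lv (n + 1) cu cv (x :: xs) [] = false := rfl

theorem walk_cons_cons {Lu Lv n cu cv : ℕ} {x y : GapCode} {xs ys : List GapCode} :
    walk d Lu Lv (n + 1) cu cv (x :: xs) (y :: ys) =
      walkStep d Lu Lv (walk d Lu Lv n) cu cv x.u x.v x.c xs y.u y.v y.c ys := rfl

/-- Invariant: only windows that start after the last mismatch, that is at P - c or later, are still
to be dealt with. Reading goes on to the next mismatch, which must come at most L letters after the
previous one; then c is reset to 0. -/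
theorem walk_sound (hd : 0 < d) {Lu Lv L δ : ℕ} (hL : σ.Rep Lu Lv L) :
    ∀ (n cu cv : ℕ) (xs ys : List GapCode) (c P : ℕ) (xs' ys' : List (ℕ × ℕ)),
      walk d Lu Lv n cu cv xs ys = true → σ.Rep cu cv c →
      List.Forall₂ (Codes σ) xs xs' → List.Forall₂ (Codes σ) ys ys' →
      Reads S P xs' → Reads S (P + δ) ys' →
      ∀ s, P ≤ s + c → s + L ≤ P + totalLength xs' →
        ∃ t < L, ¬ Compatible d (S (s + t)) (S (s + t + δ)) := by
  intro n
  induction n with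
  | zero => intro cu cv xs ys c P xs' ys' h; simp [walk_zero] at h
  | succ n ih =>
    intro cu cv xs ys c P xs' ys' h hc hxs hys hX hY s hs hsL
    have found : ∀ {q : ℕ}, s ≤ q → q < s + L →
        ¬ Compatible d (S q) (S (q + δ)) →
        ∃ t < L, ¬ Compatible d (S (s + t)) (S (s + t + δ)) := by
      intro q h1 h2 h3
      refine ⟨q - s, by omega, ?_⟩
      rwa [Nat.add_sub_cancel' h1]
    have h0 := Scale.Rep.zero σ
    cases hxs with
    | nil =>
      rw [walk_nil] at h
      -- At the end of the first stream c < L, so no remaining window fits into it.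
      simp only [Bool.and_eq_true, Bool.not_eq_true', ← Bool.not_eq_true, pairEq_iff,
        pairLe_iff] at h
      have := hc.lt hL h.1.1 h.1.2 h.2
      simp at hsL
      omega
    | @cons x x' xs xs' hx hxs =>
      cases hys with
      | nil => simp [walk_cons_nil] at h
      | @cons y y' ys ys' hy hys =>
        rw [walk_cons_cons, walkStep] at h
        obtain ⟨xl, xc⟩ := x'
        obtain ⟨yl, yc⟩ := y'
        obtain ⟨hxr, hxc⟩ := hx
        obtain ⟨hyr, hyc⟩ := hy
        dsimp only at hxr hxc hyr hyc
        simp only [totalLength_cons] at hsL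
        have hX1 := hX.1
        have hY1 := hY.1
        have hX4 := hX.2.2.2.1
        have hY4 := hY.2.2.2.1
        have hX5 := hX.2.2.2.2
        have hY5 := hY.2.2.2.2
        dsimp only at hX1 hY1 hX4 hY4 hX5 hY5
        have hshift (z : ℕ) : P + δ + z = P + z + δ := by omega
        -- A mismatch at the last of the next z letters settles all windows that start before P + z,
        -- since c + z ≤ L. Later windows are left to the rest of the walk.
        have hafter (z : ℕ) (hz : 0 < z)
            (hmis : ¬ Compatible d (S (P + (z - 1))) (S (P + δ + (z - 1))))
            (hle : c + z ≤ L)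
            (hrest : P + z ≤ s → ∃ t < L, ¬ Compatible d (S (s + t)) (S (s + t + δ))) :
            ∃ t < L, ¬ Compatible d (S (s + t)) (S (s + t + δ)) := by
          rcases le_or_gt (P + z) s with h1 | h1
          · exact hrest h1
          · rw [hshift] at hmis
            exact found (by omega) (by omega) hmis
        cases hE : pairEq x.u x.v y.u y.v <;> simp only [hE] at h
        · have hne : ¬ (x.u = y.u ∧ x.v = y.v) := by
            rw [← pairEq_iff, hE]
            simp
          cases hE2 : pairLe x.u x.v y.u y.v <;> simp only [hE2] at h
          · cases hE3 : pairLe y.u y.v x.u x.v <;> simp only [hE3, Bool.false_eq_true] at h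
            cases hE4 : pairLe (cu + y.u) (cv + y.v) Lu Lv <;>
              simp only [hE4, Bool.false_eq_true] at h
            rw [pairLe_iff] at hE3 hE4
            have hlt := hyr.lt hxr hE3.1 hE3.2 fun e => hne ⟨e.1.symm, e.2.symm⟩
            refine hafter yl hY1 (fun hC => mismatch_of_lt hd hY hX hlt (Compatible.symm hC))
              ((hc.add hyr).le hL hE4.1 hE4.2) fun h1 => ?_
            refine ih 0 0 _ _ 0 (P + yl) ((xl - yl, xc) :: xs') ys' h h0
              (.cons ⟨hyr.sub hxr hE3.1 hE3.2, hxc⟩ hxs) hys (hX.advance hlt) ?_ s h1 ?_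
            · rwa [← hshift]
            · simp only [totalLength_cons]
              omega
          · cases hE4 : pairLe (cu + x.u) (cv + x.v) Lu Lv <;>
              simp only [hE4, Bool.false_eq_true] at h
            rw [pairLe_iff] at hE2 hE4
            have hlt := hxr.lt hyr hE2.1 hE2.2 hne
            refine hafter xl hX1 (mismatch_of_lt hd hX hY hlt)
              ((hc.add hxr).le hL hE4.1 hE4.2) fun h1 => ?_
            refine ih 0 0 _ _ 0 (P + xl) xs' ((yl - xl, yc) :: ys') h h0 hxs
              (.cons ⟨hxr.sub hyr hE2.1 hE2.2, hyc⟩ hys) hX5 ?_ s h1 (by omega)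
            rw [← hshift]
            exact hY.advance hlt
        · rw [pairEq_iff] at hE
          have hxy : xl = yl := hxr.unique (by rw [hE.1, hE.2]; exact hyr)
          subst hxy
          rw [hshift] at hY5
          cases hE2 : compat d x.c y.c <;> simp only [hE2] at h
          · cases hE4 : pairLe (cu + x.u) (cv + x.v) Lu Lv <;>
              simp only [hE4, Bool.false_eq_true] at h
            rw [pairLe_iff] at hE4
            refine hafter xl hX1 (fun hC => ?_) ((hc.add hxr).le hL hE4.1 hE4.2) fun h1 =>
              ih 0 0 _ _ 0 (P + xl) xs' ys' h h0 hxs hys hX5 hY5 s h1 (by omega)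
            rw [hX4, hY4, ← hxc, ← hyc] at hC
            simp [compat_of_compatible hC] at hE2
          · exact ih _ _ _ _ (c + xl) (P + xl) xs' ys' h (hc.add hxr) hxs hys hX5 hY5 s
              (by omega) (by omega)

theorem skip_cons {g : GapCode} {gs : List GapCode} {su sv : ℕ} :
    skip (g :: gs) su sv =
      Bool.rec (Bool.rec [] (⟨g.u - su, g.v - sv, g.c⟩ :: gs) (pairLe su sv g.u g.v))
        (skip gs (su - g.u) (sv - g.v)) (pairLe g.u g.v su sv) := rfl

/-- If the shift cannot be compared with a gap, the empty stream is returned. It reads any sequence,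
so the statement survives; a walk with gaps left in its first stream rejects it. -/
theorem skip_sound {gs : List GapCode} {gs' : List (ℕ × ℕ)} (hg : List.Forall₂ (Codes σ) gs gs')
    {su sv s P : ℕ} (hs : σ.Rep su sv s) (hR : Reads S P gs') :
    ∃ l, List.Forall₂ (Codes σ) (skip gs su sv) l ∧ Reads S (P + s) l := by
  induction hg generalizing su sv s P with
  | nil => exact ⟨[], .nil, trivial⟩
  | @cons x x' xs xs' hx hxs ih =>
    rw [skip_cons]
    cases h1 : pairLe x.u x.v su sv
    · cases h2 : pairLe su sv x.u x.v
      · exact ⟨[], .nil, trivial⟩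
      · obtain ⟨xl, xc⟩ := x'
        rw [pairLe_iff] at h2
        have hlt := hs.lt hx.1 h2.1 h2.2 fun e => by
          rw [← Bool.not_eq_true, pairLe_iff] at h1
          omega
        exact ⟨(xl - s, xc) :: xs', .cons ⟨hs.sub hx.1 h2.1 h2.2, hx.2⟩ hxs, hR.advance hlt⟩
    · rw [pairLe_iff] at h1
      obtain ⟨l, hl, hl'⟩ := ih (hx.1.sub hs h1.1 h1.2) hR.2.2.2.2
      refine ⟨l, hl, ?_⟩
      have := hx.1.le hs h1.1 h1.2
      rwa [add_assoc, Nat.add_sub_cancel' this] at hl'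

theorem pairWalk_cons_cons {lu lv cu cv : ℕ} {x y : GapCode} {xs ys : List GapCode} :
    pairWalk d lu lv (x :: xs) cu cv (y :: ys) =
      Bool.rec
        (Bool.rec
          (Bool.rec false (pairLe (cu + y.u) (cv + y.v) lu lv) (pairLe y.u y.v x.u x.v))
          (pairLe (cu + x.u) (cv + x.v) lu lv)
          (pairLe x.u x.v y.u y.v))
        (Bool.rec (pairLe (cu + x.u) (cv + x.v) lu lv)
          (pairWalk d lu lv xs (cu + x.u) (cv + x.v) ys)
          (compat d x.c y.c))
        (pairEq x.u x.v y.u y.v) := rfl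

/-- Here c letters are regarded as already read; the streams must differ before letter number l.
Equal gaps are passed over, and unequal ones differ at the end of the shorter. -/
theorem pairWalk_sound (hd : 0 < d) {lu lv l : ℕ} (hl : σ.Rep lu lv l) {xs : List GapCode}
    {xs' : List (ℕ × ℕ)} (hxs : List.Forall₂ (Codes σ) xs xs') {ys : List GapCode}
    {ys' : List (ℕ × ℕ)} (hys : List.Forall₂ (Codes σ) ys ys') {cu cv c P P' : ℕ}
    (hc : σ.Rep cu cv c) (h : pairWalk d lu lv xs cu cv ys = true)
    (hX : Reads S P xs') (hY : Reads S P' ys') :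
    ∃ t, c + t < l ∧ ¬ Compatible d (S (P + t)) (S (P' + t)) := by
  induction hxs generalizing ys ys' cu cv c P P' with
  | nil => exact absurd h (by simp [pairWalk])
  | @cons x x' xs xs' hx hxs ih =>
    cases hys with
    | nil => exact absurd h (by simp [pairWalk])
    | @cons y y' ys ys' hy hys =>
      rw [pairWalk_cons_cons] at h
      have hX1 := hX.1
      have hY1 := hY.1
      cases hE : pairEq x.u x.v y.u y.v <;> simp only [hE] at h
      · have hne : ¬ (x.u = y.u ∧ x.v = y.v) := by
          rw [← pairEq_iff, hE]
          simp
        cases hE2 : pairLe x.u x.v y.u y.v <;> simp only [hE2] at h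
        · cases hE3 : pairLe y.u y.v x.u x.v <;> simp only [hE3, Bool.false_eq_true] at h
          rw [pairLe_iff] at hE3 h
          have hlt := hy.1.lt hx.1 hE3.1 hE3.2 fun e => hne ⟨e.1.symm, e.2.symm⟩
          have := (hc.add hy.1).le hl h.1 h.2
          exact ⟨y'.1 - 1, by omega,
            fun hC => mismatch_of_lt hd hY hX hlt (Compatible.symm hC)⟩
        · rw [pairLe_iff] at hE2 h
          have hlt := hx.1.lt hy.1 hE2.1 hE2.2 hne
          have := (hc.add hx.1).le hl h.1 h.2
          exact ⟨x'.1 - 1, by omega, mismatch_of_lt hd hX hY hlt⟩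
      · rw [pairEq_iff] at hE
        have hxy : x'.1 = y'.1 := hx.1.unique (by rw [hE.1, hE.2]; exact hy.1)
        cases hE2 : compat d x.c y.c <;> simp only [hE2] at h
        · rw [pairLe_iff] at h
          have := (hc.add hx.1).le hl h.1 h.2
          refine ⟨x'.1 - 1, by omega, fun hC => ?_⟩
          rw [hX.2.2.2.1, hxy, hY.2.2.2.1, ← hx.2, ← hy.2] at hC
          simp [compat_of_compatible hC] at hE2
        · have hY5 := hY.2.2.2.2
          rw [← hxy] at hY5
          obtain ⟨t, ht, hn⟩ := ih hys (hc.add hx.1) h hX.2.2.2.2 hY5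
          exact ⟨x'.1 + t, by omega, by rwa [← add_assoc, ← add_assoc]⟩

/-- Different keys force different lengths among the first r gaps; comparability turns different
pairs into different numbers. The mismatch comes within r gaps of length at most N. A collision of
keys is harmless, as it only adds a pair to be compared. -/
theorem key_sound (hd : 0 < d) {N : ℕ} {xs ys : List GapCode} {xs' ys' : List (ℕ × ℕ)}
    (hxs : List.Forall₂ (Codes σ) xs xs') (hys : List.Forall₂ (Codes σ) ys ys')
    (hbx : ∀ g ∈ xs', g.1 ≤ N)
    (hcmp : ∀ x ∈ xs, ∀ y ∈ ys, x.u ≤ y.u ∧ x.v ≤ y.v ∨ y.u ≤ x.u ∧ y.v ≤ x.v) {r : ℕ}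
    (hrx : r ≤ xs.length) (hry : r ≤ ys.length) (hkey : key r xs ≠ key r ys) {P P' : ℕ}
    (hX : Reads S P xs') (hY : Reads S P' ys') :
    ∃ t < r * N, ¬ Compatible d (S (P + t)) (S (P' + t)) := by
  induction r generalizing xs ys xs' ys' P P' with
  | zero => exact absurd rfl hkey
  | succ r ih =>
    cases hxs with
    | nil => simp at hrx
    | @cons x x' xs xs' hx hxs =>
      cases hys with
      | nil => simp at hry
      | @cons y y' ys ys' hy hys =>
        have hxN := hbx x' (by simp)
        by_cases he : x'.1 = y'.1
        · have hxy : x.u = y.u ∧ x.v = y.v := by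
            by_contra hne
            rcases hcmp x (by simp) y (by simp) with h | h
            · have := hx.1.lt hy.1 h.1 h.2 hne
              omega
            · have := hy.1.lt hx.1 h.1 h.2 fun e => hne ⟨e.1.symm, e.2.symm⟩
              omega
          have hkey' : key r xs ≠ key r ys := fun e => hkey (by simp [key, hxy, e])
          have hY5 := hY.2.2.2.2
          rw [← he] at hY5
          obtain ⟨t, ht, hn⟩ := ih hxs hys (fun g hg => hbx g (by simp [hg]))
            (fun x hx y hy => hcmp x (by simp [hx]) y (by simp [hy])) (by simpa using hrx)
            (by simpa using hry) hkey' hX.2.2.2.2 hY5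
          exact ⟨x'.1 + t, by rw [add_mul]; omega, by rwa [← add_assoc, ← add_assoc]⟩
        · obtain ⟨t, ht, -, hn⟩ := mismatch_of_ne hd hX hY he
          exact ⟨t, by rw [add_mul]; omega, hn⟩

end GapCode

/-! ### Soundness of the search over pairs of gaps. -/

namespace GapCode

variable {S : ℕ → ℕ} {σ : Scale} {d : ℕ}

/-- The first `n` items of a list of gaps. -/
def mkItems (r : ℕ) : ℕ → List GapCode → List Item
  | 0, _ => []
  | _ + 1, [] => []
  | n + 1, x :: xs => ⟨key r xs, x, xs⟩ :: mkItems r n xs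

theorem withItems_eq {r : ℕ} {K : List Item → Bool} {n : ℕ} {xs : List GapCode} {acc : List Item}
    (h : withItems r K n xs acc = true) : K ((mkItems r n xs).reverse ++ acc) = true := by
  induction n generalizing xs acc with
  | zero => simpa [withItems, mkItems] using h
  | succ n ih =>
    cases xs with
    | nil => simp [withItems] at h
    | cons x xs =>
      have h' : withItems r K n xs (⟨key r xs, x, xs⟩ :: acc) = true := h
      simpa [mkItems] using ih h'

theorem getElem?_mkItems {r n i : ℕ} {xs : List GapCode} (hi : i < n) (hx : i < xs.length) :
    (mkItems r n xs)[i]? = some ⟨key r (xs.drop (i + 1)), xs[i], xs.drop (i + 1)⟩ := by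
  induction n generalizing i xs with
  | zero => omega
  | succ n ih =>
    cases xs with
    | nil => simp at hx
    | cons x xs =>
      cases i with
      | zero => simp [mkItems]
      | succ i => simpa [mkItems] using ih (by omega) (by simpa using hx)

theorem pairsAt_sound {lu lv : ℕ} {x : Item} {l : List Item} (h : pairsAt d lu lv x l = true) :
    ∀ y ∈ l, x.key = y.key → pairStart d lu lv x y = true := by
  induction l with
  | nil => simp
  | cons y l ih =>
    have h' : (Bool.rec (pairsAt d lu lv x l) (and (pairStart d lu lv x y) (pairsAt d lu lv x l))
      (Nat.beq x.key y.key) : Bool) = true := h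
    cases hk : Nat.beq x.key y.key <;> simp only [hk, Bool.and_eq_true] at h'
    · have hne : x.key ≠ y.key := fun e => by simp [e] at hk
      simpa [hne] using ih h'
    · simpa [h'.1] using ih h'.2

theorem pairs_sound {lu lv : ℕ} {l : List Item} (h : pairs d lu lv l = true) :
    l.Pairwise fun x y => x.key = y.key → pairStart d lu lv x y = true := by
  induction l with
  | nil => simp
  | cons x l ih =>
    have h' : (pairsAt d lu lv x l && pairs d lu lv l) = true := h
    rw [Bool.and_eq_true] at h'
    exact List.pairwise_cons.2 ⟨pairsAt_sound h'.1, ih h'.2⟩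

/-- The items are accumulated in reverse order, so in each compared pair the later gap comes first.
-/
theorem pairStart_of_lt {lu lv r n i j : ℕ} {xs : List GapCode}
    (h : withItems r (pairs d lu lv) n xs [] = true) (hij : i < j) (hj : j < n)
    (hx : j < xs.length) (hkey : key r (xs.drop (j + 1)) = key r (xs.drop (i + 1))) :
    pairStart d lu lv ⟨key r (xs.drop (j + 1)), xs[j], xs.drop (j + 1)⟩
      ⟨key r (xs.drop (i + 1)), xs[i], xs.drop (i + 1)⟩ = true := by
  have h1 := pairs_sound (withItems_eq h)
  rw [List.append_nil, List.pairwise_reverse, List.pairwise_iff_getElem] at h1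
  obtain ⟨hj1, hj2⟩ := List.getElem?_eq_some_iff.1 (getElem?_mkItems (r := r) hj hx)
  obtain ⟨hi1, hi2⟩ := List.getElem?_eq_some_iff.1
    (getElem?_mkItems (r := r) (hij.trans hj) (hij.trans hx))
  have h2 := h1 i j hi1 hj1 hij
  rw [hj2, hi2] at h2
  exact h2 hkey

/-- A factor may start inside both gaps, z letters before their ends. The check assumes the largest
possible z, the smaller of the two gap lengths, which leaves the fewest letters to find a mismatch.
-/
theorem pairStart_sound (hd : 0 < d) {lu lv l : ℕ} (hl : σ.Rep lu lv l) {x y : Item}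
    (h : pairStart d lu lv x y = true) {x' y' : ℕ × ℕ} {xs ys : List (ℕ × ℕ)}
    (hx : Codes σ x.head x') (hy : Codes σ y.head y') (hxs : List.Forall₂ (Codes σ) x.tail xs)
    (hys : List.Forall₂ (Codes σ) y.tail ys) {z P P' : ℕ} (hz : z ≤ x'.1) (hz' : z ≤ y'.1)
    (hzl : z ≤ l) (hX : Reads S P ((z, x'.2) :: xs)) (hY : Reads S P' ((z, y'.2) :: ys)) :
    ∃ t < l, ¬ Compatible d (S (P + t)) (S (P' + t)) := by
  unfold pairStart at h
  have hz0 : 0 < z := hX.1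
  cases hc : compat d x.head.c y.head.c <;> simp only [hc] at h
  · refine ⟨z - 1, by omega, fun hC => ?_⟩
    have h1 : S (P + (z - 1)) = x'.2 := hX.2.2.2.1
    have h2 : S (P' + (z - 1)) = y'.2 := hY.2.2.2.1
    rw [h1, h2, ← hx.2, ← hy.2] at hC
    simp [compat_of_compatible hC] at hc
  · have hX5 : Reads S (P + z) xs := hX.2.2.2.2
    have hY5 : Reads S (P' + z) ys := hY.2.2.2.2
    have main : ∀ {cu cv c : ℕ}, σ.Rep cu cv c → z ≤ c →
        pairWalk d lu lv x.tail cu cv y.tail = true →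
        ∃ t < l, ¬ Compatible d (S (P + t)) (S (P' + t)) := by
      intro cu cv c hc hzc h
      obtain ⟨t, ht, hn⟩ := pairWalk_sound hd hl hxs hys hc h hX5 hY5
      exact ⟨z + t, by omega, by rwa [← add_assoc, ← add_assoc]⟩
    cases hle : pairLe x.head.u x.head.v y.head.u y.head.v <;> simp only [hle] at h
    · cases hle' : pairLe y.head.u y.head.v x.head.u x.head.v <;>
        simp only [hle', Bool.false_eq_true] at h
      exact main hy.1 hz' h
    · exact main hx.1 hz h

theorem exists_mem_types {G : List GapCode} {g : GapCode} (hg : g ∈ G) :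
    ∃ h ∈ types G, g.u = h.u ∧ g.v = h.v := by
  induction G with
  | nil => simp at hg
  | cons x G ih =>
    have ht : types (x :: G) = bif (types G).any (fun h => pairEq x.u x.v h.u h.v) then types G
      else x :: types G := rfl
    have hsub : ∀ h ∈ types G, h ∈ types (x :: G) := by
      intro h hh
      rw [ht]
      cases (types G).any (fun h => pairEq x.u x.v h.u h.v) <;> simp [hh]
    rcases List.mem_cons.1 hg with rfl | hg
    · cases ha : (types G).any (fun h => pairEq g.u g.v h.u h.v)
      · exact ⟨g, by rw [ht, ha]; simp, rfl, rfl⟩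
      · obtain ⟨h, hh, he⟩ := List.any_eq_true.1 ha
        exact ⟨h, hsub h hh, pairEq_iff.1 he⟩
    · obtain ⟨h, hh, he⟩ := ih hg
      exact ⟨h, hsub h hh, he⟩

theorem keyCheck_sound {G : List GapCode} {lu lv r : ℕ} (h : keyCheck G lu lv r = true) :
    r = 0 ∨ r ≤ G.length ∧ (∀ x ∈ G, (r + 1) * x.u ≤ lu ∧ (r + 1) * x.v ≤ lv) ∧
      ∀ x ∈ G, ∀ y ∈ G, x.u ≤ y.u ∧ x.v ≤ y.v ∨ y.u ≤ x.u ∧ y.v ≤ x.v := by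
  cases r with
  | zero => exact Or.inl rfl
  | succ r =>
    simp only [keyCheck, Bool.and_eq_true, Bool.or_eq_true, List.all_eq_true, pairLe_iff,
      Nat.ble_eq] at h
    refine Or.inr ⟨h.1, fun x hx => ?_, fun x hx y hy => ?_⟩
    · obtain ⟨x', hx', e1, e2⟩ := exists_mem_types hx
      rw [e1, e2]
      exact (h.2 x' hx').1
    · obtain ⟨x', hx', e1, e2⟩ := exists_mem_types hx
      obtain ⟨y', hy', e3, e4⟩ := exists_mem_types hy
      rw [e1, e2, e3, e4]
      exact (h.2 x' hx').2 y' hy'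

theorem exists_code {G : List GapCode} {G' : List (ℕ × ℕ)} (hG : List.Forall₂ (Codes σ) G G')
    {g : ℕ × ℕ} (hg : g ∈ G') : ∃ x ∈ G, Codes σ x g := by
  induction hG with
  | nil => simp at hg
  | @cons x x' xs xs' hx hxs ih =>
    rcases List.mem_cons.1 hg with rfl | hg
    · exact ⟨x, by simp, hx⟩
    · obtain ⟨y, hy, hy'⟩ := ih hg
      exact ⟨y, by simp [hy], hy'⟩

/-- A nonzero letter in the window lets the first gap end inside it, and compatibility makes the
remaining pieces of the two first gaps equally long. Two different gaps are then separated by the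
pair check or, if their keys differ, by `key_sound`. -/
theorem locate_sound (hd : 0 < d) {lu lv l r : ℕ} (hl : σ.Rep lu lv l) {G : List GapCode}
    {G' : List (ℕ × ℕ)} (hG : List.Forall₂ (Codes σ) G G') (hkey : keyCheck G lu lv r = true)
    (hpairs : withItems r (pairs d lu lv) G.length (G ++ G) [] = true)
    (hR : Reads S 0 (G' ++ G')) {q q' : ℕ} (hq : q < totalLength G') (hq' : q' < totalLength G')
    (hC : ∀ t < l, Compatible d (S (q + t)) (S (q' + t))) (hne : ∃ t < l, S (q + t) ≠ 1) :
    q = q' := by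
  have hlen := hG.length_eq
  obtain ⟨i, hi, x, hx0, hxi, hRx, hqx⟩ :=
    hR.exists_suffix G' G' (Nat.zero_le q) (by simpa using hq)
  obtain ⟨j, hj, y, hy0, hyj, hRy, hqy⟩ :=
    hR.exists_suffix G' G' (Nat.zero_le q') (by simpa using hq')
  -- Otherwise the window would lie within a run of zeros.
  have hxl : x ≤ l := by
    by_contra! hlt
    obtain ⟨t, ht, hn⟩ := hne
    exact hn (hRx.2.2.1 t (by dsimp only; omega))
  have hxy : x = y := by
    by_contra hxy
    obtain ⟨t, ht, -, hn⟩ := mismatch_of_ne hd hRx hRy hxy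
    dsimp only at ht
    exact hn (hC t (by omega))
  subst hxy
  have hGG : List.Forall₂ (Codes σ) (G ++ G) (G' ++ G') := List.rel_append hG hG
  have hmem : ∀ (n : ℕ) (x : GapCode), x ∈ (G ++ G).drop n → x ∈ G := fun n x h => by
    simpa using List.mem_of_mem_drop h
  have hmem' : ∀ (n : ℕ) (x : ℕ × ℕ), x ∈ (G' ++ G').drop n → x ∈ G' := fun n x h => by
    simpa using List.mem_of_mem_drop h
  have main : ∀ (i j : ℕ) (hi : i < G'.length) (hj : j < G'.length), i < j →
      ∀ P P', x ≤ G'[i].1 → x ≤ G'[j].1 →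
      Reads S P ((x, G'[i].2) :: (G' ++ G').drop (i + 1)) →
      Reads S P' ((x, G'[j].2) :: (G' ++ G').drop (j + 1)) →
      ∃ t < l, ¬ Compatible d (S (P' + t)) (S (P + t)) := by
    intro i j hi hj hij P P' hxi hxj hRi hRj
    by_cases he : key r ((G ++ G).drop (j + 1)) = key r ((G ++ G).drop (i + 1))
    · have hps := pairStart_of_lt hpairs hij (by omega) (by simp; omega) he
      refine pairStart_sound hd hl hps (x' := G'[j]) (y' := G'[i]) ?_ ?_
        (List.forall₂_drop _ hGG) (List.forall₂_drop _ hGG) hxj hxi hxl hRj hRi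
      · simp only [List.getElem_append_left (show j < G.length by omega)]
        exact hG.get (by omega) hj
      · simp only [List.getElem_append_left (show i < G.length by omega)]
        exact hG.get (by omega) hi
    · rcases keyCheck_sound hkey with rfl | ⟨hr, hmax, hcmp⟩
      · exact absurd rfl he
      -- The cut first gap and the r gaps after it have at most l / (r + 1) letters each, so
      -- together at most l.
      have hbound : ∀ g ∈ G', g.1 ≤ l / (r + 1) := by
        intro g hg
        obtain ⟨c, hc, hcg⟩ := exists_code hG hg
        rw [Nat.le_div_iff_mul_le (by omega), mul_comm]
        exact (hcg.1.smul (r + 1)).le hl (hmax c hc).1 (hmax c hc).2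
      obtain ⟨t, ht, hn⟩ := key_sound hd (List.forall₂_drop (j + 1) hGG)
        (List.forall₂_drop (i + 1) hGG) (fun g hg => hbound g (hmem' _ g hg))
        (fun u hu v hv => hcmp u (hmem _ u hu) v (hmem _ v hv))
        (by simp; omega) (by simp; omega) he hRj.2.2.2.2 hRi.2.2.2.2
      refine ⟨x + t, ?_, by rwa [← add_assoc, ← add_assoc]⟩
      have h1 := hbound _ (List.getElem_mem hi)
      have h2 := Nat.div_mul_le_self l (r + 1)
      have h3 : l / (r + 1) * (r + 1) = r * (l / (r + 1)) + l / (r + 1) := by ring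
      omega
  rcases lt_trichotomy i j with hij | rfl | hij
  · obtain ⟨t, ht, hn⟩ := main i j hi hj hij q q' hxi hyj hRx hRy
    exact absurd (Compatible.symm (hC t ht)) hn
  -- In the same gap with the same remaining length, q + x = q' + x is the end of that gap.
  · omega
  · obtain ⟨t, ht, hn⟩ := main j i hj hi hij q' q hyj hxi hRy hRx
    exact absurd (hC t ht) hn

/-! ### The periodic sequence with given gaps. -/

/-- The codes of the letters of a word with the given gaps. -/
def codeWord (l : List (ℕ × ℕ)) : List ℕ :=
  l.flatMap fun g => List.replicate (g.1 - 1) 1 ++ [g.2]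

theorem length_codeWord {l : List (ℕ × ℕ)} (hl : ∀ g ∈ l, 0 < g.1) :
    (codeWord l).length = totalLength l := by
  induction l with
  | nil => rfl
  | cons g l ih =>
    have h1 := hl g (by simp)
    have h2 := ih fun g hg => hl g (by simp [hg])
    simp only [codeWord, List.flatMap_cons, List.length_append, List.length_replicate,
      List.length_singleton, totalLength_cons] at h2 ⊢
    omega

theorem reads_of_codeWord {l : List (ℕ × ℕ)} (hl : ∀ g ∈ l, 0 < g.1 ∧ g.2 ≠ 1) {P : ℕ}
    (h : ∀ t < totalLength l, (codeWord l)[t]? = some (S (P + t))) : Reads S P l := by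
  induction l generalizing P with
  | nil => trivial
  | cons g l ih =>
    obtain ⟨h1, h2⟩ := hl g (by simp)
    simp only [codeWord, List.flatMap_cons, totalLength_cons, List.append_assoc] at h
    refine ⟨h1, h2, fun t ht => ?_, ?_, ih (fun g hg => hl g (by simp [hg])) fun t ht => ?_⟩
    · have := h t (by omega)
      rw [List.getElem?_append_left (by simp; omega), List.getElem?_replicate,
        if_pos (by omega)] at this
      simpa using this.symm
    · have := h (g.1 - 1) (by omega)
      rw [List.getElem?_append_right (by simp)] at this
      simpa using this.symm
    · have := h (g.1 + t) (by omega)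
      rw [List.getElem?_append_right (by simp; omega), List.length_replicate,
        show g.1 + t - (g.1 - 1) = t + 1 by omega] at this
      simpa [add_assoc, codeWord] using this

/-- The periodic sequence of codes with the given gaps. -/
def codeSequence (l : List (ℕ × ℕ)) (q : ℕ) : ℕ := (codeWord l).getD (q % totalLength l) 0

theorem codeSequence_mul_add (l : List (ℕ × ℕ)) (i q : ℕ) :
    codeSequence l (i * totalLength l + q) = codeSequence l q := by
  rw [codeSequence, Nat.mul_add_mod_self_right, codeSequence]

theorem reads_codeSequence {l : List (ℕ × ℕ)} (hl : ∀ g ∈ l, 0 < g.1 ∧ g.2 ≠ 1) (i n : ℕ) :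
    Reads (codeSequence l) (i * totalLength l) (List.replicate n l).flatten := by
  induction n generalizing i with
  | zero => simp [Reads]
  | succ n ih =>
    rw [List.replicate_succ, List.flatten_cons, Reads.append_iff]
    refine ⟨reads_of_codeWord hl fun t ht => ?_, by simpa [add_mul] using ih (i + 1)⟩
    have hlen := length_codeWord fun g hg => (hl g hg).1
    rw [codeSequence_mul_add, codeSequence, Nat.mod_eq_of_lt ht,
      List.getElem?_eq_getElem (by omega), List.getD_eq_getElem _ _ (by omega)]

end GapCode

/-! ### Linear forms on cells, and subdivision of the range of a/b. -/

namespace GapCode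

variable {σ : Scale} {a b p q p' q' : ℕ}

/-- Representation is linear in (a, b): nonnegative values at both ends of a cell give a nonnegative
number represented by them. -/
theorem withLin_sound {i j : ℤ} {K : ℕ → ℕ → Bool} (ha : σ.Rep p p' a) (hb : σ.Rep q q' b)
    (h : withLin p q p' q' i j K = true) :
    ∃ u v, K u v = true ∧ 0 ≤ i * a + j * b ∧ σ.Rep u v (i * a + j * b).toNat := by
  simp only [withLin, Bool.and_eq_true, decide_eq_true_eq] at h
  obtain ⟨h1, h2, h3⟩ := h
  have e : (σ.D : ℤ) * (i * a + j * b) = σ.s * lin p q i j + σ.t * lin p' q' i j := by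
    unfold Scale.Rep at ha hb
    zify at ha hb
    simp only [lin]
    linear_combination i * ha + j * hb
  have hpos : 0 ≤ i * (a : ℤ) + j * b := by
    refine nonneg_of_mul_nonneg_right (a := (σ.D : ℤ)) ?_ (by exact_mod_cast σ.D_pos)
    rw [e]
    positivity
  refine ⟨_, _, h3, hpos, ?_⟩
  unfold Scale.Rep
  zify
  rw [Int.toNat_of_nonneg h1, Int.toNat_of_nonneg h2, Int.toNat_of_nonneg hpos, e]

/-- The gap described by `(i, j, c)` for given values of `a` and `b`. -/
def gapValue (a b : ℕ) (r : ℤ × ℤ × ℕ) : ℕ × ℕ := ((r.1 * a + r.2.1 * b : ℤ).toNat, r.2.2)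

theorem withGaps_sound {K : List GapCode → Bool} {l : List (ℤ × ℤ × ℕ)} {acc : List GapCode}
    {acc' : List (ℕ × ℕ)} (ha : σ.Rep p p' a) (hb : σ.Rep q q' b)
    (hacc : List.Forall₂ (Codes σ) acc acc') (h : withGaps p q p' q' K l acc = true) :
    ∃ G, K G = true ∧ List.Forall₂ (Codes σ) G (l.reverse.map (gapValue a b) ++ acc') ∧
      ∀ r ∈ l, 0 < r.1 * (a : ℤ) + r.2.1 * b := by
  induction l generalizing acc acc' with
  | nil => exact ⟨acc, h, by simpa using hacc, by simp⟩
  | cons r l ih =>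
    obtain ⟨u, v, h1, h2, h3⟩ := withLin_sound ha hb h
    rw [Bool.and_eq_true, Nat.ble_eq] at h1
    obtain ⟨G, hK, hG, hpos⟩ := ih (acc' := gapValue a b r :: acc') (.cons ⟨h3, rfl⟩ hacc) h1.2
    refine ⟨G, hK, by simpa using hG, List.forall_mem_cons.2 ⟨?_, hpos⟩⟩
    have := (Scale.Rep.zero σ).lt h3 (Nat.zero_le u) (Nat.zero_le v) (by omega)
    omega

/-- The gaps between consecutive nonzero letters of `φ(n)`. -/
def gaps (F : SymbolicMorphism) (a b : ℕ) : List (ℕ × ℕ) :=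
  (codedBlocks F).map (gapValue a b)

theorem withGaps_codedBlocks {F : SymbolicMorphism} {K : List GapCode → Bool}
    (ha : σ.Rep p p' a) (hb : σ.Rep q q' b)
    (h : withGaps p q p' q' K (codedBlocks F).reverse [] = true) :
    ∃ G, K G = true ∧ List.Forall₂ (Codes σ) G (gaps F a b) ∧
      ∀ r ∈ codedBlocks F, 0 < r.1 * (a : ℤ) + r.2.1 * b := by
  obtain ⟨G, h1, h2, h3⟩ := withGaps_sound ha hb .nil h
  exact ⟨G, h1, by simpa [gaps] using h2, fun r hr => h3 r (by simpa using hr)⟩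

/-- The conditions on `a` and `b` that belong to `I` and `s`. -/
structure Range.Contains (I : Range) (s a b : ℕ) : Prop where
  pos : 0 < b
  coprime : Nat.Coprime a b
  lo : I.lo.1 * b < a * I.lo.2 ∨ I.incl = true ∧ a * I.lo.2 = I.lo.1 * b
  hi : a * I.hi.2 < I.hi.1 * b
  notMem : ∀ e ∈ I.ex, 1 ≤ e.2 → a * e.2 ≠ e.1 * b
  gcd : Nat.gcd b s = 1

/-- Since a/b is in lowest terms, (x, y) = g (a, b), which gives a scale with D = g. An exempt point
contradicts the exclusions or, when g = 1, the condition gcd(b, s) = 1. -/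
theorem pointCheck_sound {I : Range} {s x y : ℕ} (hI : I.Contains s a b)
    {f : ℕ → ℕ → ℕ → ℕ → Bool} (hxy : a * y = x * b) (h : pointCheck f I.ex s x y = true) :
    ∃ p q p' q', f p q p' q' = true ∧ ∃ σ : Scale, σ.Rep p p' a ∧ σ.Rep q q' b := by
  simp only [pointCheck, Bool.and_eq_true, Bool.or_eq_true, Nat.ble_eq] at h
  obtain ⟨hy, h⟩ := h
  obtain ⟨g, rfl⟩ : b ∣ y := hI.coprime.symm.dvd_of_dvd_mul_left (hxy ▸ Dvd.intro_left x rfl)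
  have hg : 0 < g := Nat.pos_of_mul_pos_left (by omega : 0 < b * g)
  have hx : x = a * g := by
    refine Nat.eq_of_mul_eq_mul_right hI.pos ?_
    rw [← hxy]
    ring
  subst hx
  rcases h with h | h
  · simp only [exempt, Bool.or_eq_true, List.any_eq_true, Bool.and_eq_true, Nat.ble_eq,
      Nat.beq_eq, Bool.not_eq_true', Nat.gcd_mul_right] at h
    rcases h with ⟨e, he, h1, h2⟩ | ⟨h1, h2⟩
    · refine absurd ?_ (hI.notMem e he h1)
      refine Nat.eq_of_mul_eq_mul_right hg ?_
      rw [mul_right_comm, ← h2, mul_assoc]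
    · have hg1 : g = 1 := Nat.eq_one_of_mul_eq_one_left h1
      subst hg1
      simp [hI.gcd] at h2
  · exact ⟨_, _, _, _, h, ⟨⟨g, 1, 1, hg, one_pos, one_pos⟩, by simp [Scale.Rep, mul_comm],
      by simp [Scale.Rep, mul_comm]⟩⟩

/-- Cramer's rule: D = p' q - p q', with weights p' b - a q' and a q - p b. The weights are positive
by the strict inequalities, and b D = q (p' b - a q') + q' (a q - p b) shows D > 0. -/
theorem exists_scale (hb : 0 < b) (hlo : p * b < a * q) (hhi : a * q' < p' * b) :
    ∃ σ : Scale, σ.Rep p p' a ∧ σ.Rep q q' b := by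
  have hq : 0 < q := Nat.pos_of_mul_pos_left (by omega : 0 < a * q)
  have hD : 0 < (p' * q - p * q' : ℤ) := by
    zify at hlo hhi hb hq
    refine pos_of_mul_pos_right (a := (b : ℤ)) ?_ hb.le
    nlinarith [mul_lt_mul_of_pos_right hhi hq, mul_le_mul_of_nonneg_right hlo.le
      (Int.natCast_nonneg q')]
  refine ⟨⟨(p' * q - p * q' : ℤ).toNat, p' * b - a * q', a * q - p * b, by omega, by omega,
    by omega⟩, ?_, ?_⟩
  all_goals
    unfold Scale.Rep
    zify [hlo.le, hhi.le]
    rw [Int.toNat_of_nonneg hD.le]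
    ring

/-- The value a/b lies to the left of a breakpoint, on it or to its right, and each case has its own
check. Any list of breakpoints is sound. -/
theorem refine_sound {I : Range} {s : ℕ} (hI : I.Contains s a b) {f : ℕ → ℕ → ℕ → ℕ → Bool}
    {l : List (ℕ × ℕ)} {p q p' q' : ℕ} (hlo : p * b < a * q) (hhi : a * q' < p' * b)
    (h : refine f I.ex s p q p' q' l = true) :
    ∃ p q p' q', f p q p' q' = true ∧ ∃ σ : Scale, σ.Rep p p' a ∧ σ.Rep q q' b := by
  induction l generalizing p q p' q' with
  | nil => exact ⟨p, q, p', q', h, exists_scale hI.pos hlo hhi⟩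
  | cons z l ih =>
    rw [refine, Bool.or_eq_true] at h
    rcases h with h | h
    · exact ⟨p, q, p', q', h, exists_scale hI.pos hlo hhi⟩
    cases hin : (Nat.ble (p * z.2 + 1) (z.1 * q) && Nat.ble (z.1 * q' + 1) (p' * z.2)) <;>
      simp only [hin, cond_true, cond_false, Bool.and_eq_true] at h
    · exact ih hlo hhi h
    · rcases lt_trichotomy (a * z.2) (z.1 * b) with hz | hz | hz
      · exact ih hlo hz h.1
      · exact pointCheck_sound hI hz h.2.1
      · exact ih hz hhi h.2.2

theorem Range.check_sound {I : Range} {s : ℕ} (hI : I.Contains s a b)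
    {f : ℕ → ℕ → ℕ → ℕ → Bool} {l : List (ℕ × ℕ)} (h : I.check s f l = true) :
    ∃ p q p' q', f p q p' q' = true ∧ ∃ σ : Scale, σ.Rep p p' a ∧ σ.Rep q q' b := by
  rw [Range.check, Bool.and_eq_true] at h
  rcases hI.lo with h1 | ⟨h1, h2⟩
  · exact refine_sound hI h1 hI.hi h.2
  · exact pointCheck_sound hI h2 (by simpa [h1] using h.1)

end GapCode

/-! ### From the symbolic morphism to its sequence of codes. -/

namespace GapCode

variable {σ : Scale} {a b : ℕ} {F : SymbolicMorphism}

theorem staticCheck_iff : staticCheck F = true ↔ 1 ≤ F.d ∧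
    F.nonzeroLetters = F.blocks.length + 1 ∧ 2 ≤ F.nonzeroLetters ∧ (∀ r ∈ F.blocks, 1 ≤ r.2.2) ∧
    (F.blocks.map fun r => r.1).sum + F.last.1 = F.s ∧
    (F.blocks.map fun r => r.2.1).sum + F.last.2 = -F.t := by
  simp only [staticCheck, Bool.and_eq_true, decide_eq_true_eq, Nat.ble_eq, Nat.beq_eq,
    List.all_eq_true]

theorem describes_block {d x c : ℕ} {z : ℤ} (hx : Describes d c x) :
    List.Forall₂ (Describes d) (List.replicate (z.toNat - 1) 1 ++ [c])
      (List.replicate (z - 1).toNat 0 ++ [x]) := by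
  rw [show (z - 1).toNat = z.toNat - 1 by omega]
  refine List.rel_append ?_ (.cons hx .nil)
  induction z.toNat - 1 with
  | zero => exact .nil
  | succ n ih => exact .cons (Or.inr rfl) ih

theorem describes_morphism (n : ℕ) :
    List.Forall₂ (Describes F.d) (codeWord (gaps F a b)) (F.morphism a b n) := by
  unfold codeWord gaps codedBlocks SymbolicMorphism.morphism
  rw [List.map_append, List.flatMap_append, List.map_map]
  refine List.rel_append ?_ ?_
  · induction F.blocks with
    | nil => exact .nil
    | cons r l ih => exact List.rel_append (describes_block (Or.inr rfl)) ih
  · rw [List.map_singleton, List.flatMap_singleton]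
    exact describes_block (Or.inl ⟨rfl, Nat.le_add_left _ _⟩)

theorem gaps_pos (hs : staticCheck F = true)
    (hpos : ∀ r ∈ codedBlocks F, 0 < r.1 * (a : ℤ) + r.2.1 * b) :
    ∀ g ∈ gaps F a b, 0 < g.1 ∧ g.2 ≠ 1 := by
  intro g hg
  obtain ⟨r, hr, rfl⟩ := List.mem_map.1 hg
  refine ⟨by have := hpos r hr; simp only [gapValue]; omega, ?_⟩
  obtain ⟨-, -, -, hb, -⟩ := staticCheck_iff.1 hs
  rcases List.mem_append.1 hr with h | h
  · obtain ⟨r', hr', rfl⟩ := List.mem_map.1 h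
    have := hb r' hr'
    simp only [gapValue]
    omega
  · rw [List.mem_singleton.1 h]
    simp [gapValue]

theorem morphism_eq (n : ℕ) : ∃ w : List ℕ, F.morphism a b n = w ++ [n + F.d] :=
  ⟨F.blocks.flatMap (fun r => SymbolicMorphism.block a b r.1 r.2.1 r.2.2) ++
    List.replicate (SymbolicMorphism.runLength a b F.last.1 F.last.2).toNat 0, by
    simp [SymbolicMorphism.morphism, SymbolicMorphism.block]⟩

theorem describedBy (hs : staticCheck F = true)
    (hpos : ∀ r ∈ codedBlocks F, 0 < r.1 * (a : ℤ) + r.2.1 * b) :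
    DescribedBy F.d (totalLength (gaps F a b)) (F.morphism a b) (codeSequence (gaps F a b)) := by
  have hlen := length_codeWord fun g hg => (gaps_pos hs hpos g hg).1
  have huni : IsUniformMorphism (totalLength (gaps F a b)) (F.morphism a b) := fun n => by
    rw [← hlen, (describes_morphism n).length_eq]
  have hk : 0 < totalLength (gaps F a b) := by
    obtain ⟨w, hw⟩ := morphism_eq (F := F) (a := a) (b := b) 0
    rw [← huni 0, hw]
    simp
  refine ⟨hk, huni, fun n => ?_, fun n r y hy => ?_, fun i r => codeSequence_mul_add _ i r⟩
  · obtain ⟨w, hw⟩ := morphism_eq (F := F) (a := a) (b := b) n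
    rw [← huni n, hw]
    simp
  · obtain ⟨hr, rfl⟩ := List.getElem?_eq_some_iff.1 hy
    have hr' : r < (codeWord (gaps F a b)).length := by
      rwa [(describes_morphism n).length_eq]
    rw [codeSequence, Nat.mod_eq_of_lt (by omega), List.getD_eq_getElem _ _ hr']
    exact (describes_morphism n).get hr' hr

/-- All gaps are positive, so truncation to natural numbers loses nothing and the coefficients add
up. -/
theorem totalLength_gaps (hs : staticCheck F = true)
    (hpos : ∀ r ∈ codedBlocks F, 0 < r.1 * (a : ℤ) + r.2.1 * b) :
    (totalLength (gaps F a b) : ℤ) = F.s * a - F.t * b := by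
  obtain ⟨-, -, -, -, h1, h2⟩ := staticCheck_iff.1 hs
  have key : ∀ l : List (ℤ × ℤ × ℕ), (∀ r ∈ l, 0 < r.1 * (a : ℤ) + r.2.1 * b) →
      (totalLength (l.map (gapValue a b)) : ℤ) =
        (l.map fun r => r.1).sum * a + (l.map fun r => r.2.1).sum * b := by
    intro l hl
    induction l with
    | nil => simp
    | cons r l ih =>
      have := hl r (by simp)
      rw [List.map_cons, totalLength_cons, Nat.cast_add, ih fun r hr => hl r (by simp [hr]),
        gapValue, Int.toNat_of_nonneg this.le, List.map_cons, List.map_cons, List.sum_cons,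
        List.sum_cons]
      ring
  rw [gaps, key _ hpos]
  have e1 : (codedBlocks F).map (fun r => r.1) = F.blocks.map (fun r => r.1) ++ [F.last.1] := by
    simp [codedBlocks]
  have e2 : (codedBlocks F).map (fun r => r.2.1) =
      F.blocks.map (fun r => r.2.1) ++ [F.last.2] := by
    simp [codedBlocks]
  rw [e1, e2, List.sum_append, List.sum_append, List.sum_singleton, List.sum_singleton, h1, h2]
  ring

theorem filter_morphism (hs : staticCheck F = true) (n : ℕ) :
    ((F.morphism a b n).filter (fun x => x ≠ 0)).length = F.nonzeroLetters := by
  obtain ⟨hd, hN, -, hb, -⟩ := staticCheck_iff.1 hs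
  have hblock : ∀ (i j : ℤ) (x : ℕ), 1 ≤ x →
      ((SymbolicMorphism.block a b i j x).filter (fun x => x ≠ 0)).length = 1 := by
    intro i j x hx
    have hx' : x ≠ 0 := by omega
    simp [SymbolicMorphism.block, List.filter_append, hx']
  rw [hN, SymbolicMorphism.morphism, List.filter_append, List.length_append,
    hblock _ _ _ (by omega)]
  congr 1
  revert hb
  clear hN
  induction F.blocks with
  | nil => exact fun _ => rfl
  | cons r l ih =>
    intro hb
    rw [List.flatMap_cons, List.filter_append, List.length_append, hblock _ _ _ (hb r (by simp)),
      ih fun r hr => hb r (by simp [hr]), List.length_cons, add_comm]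

theorem two_le_totalLength (hs : staticCheck F = true)
    (hpos : ∀ r ∈ codedBlocks F, 0 < r.1 * (a : ℤ) + r.2.1 * b) :
    2 ≤ totalLength (gaps F a b) := by
  obtain ⟨-, -, h2, -⟩ := staticCheck_iff.1 hs
  rw [← filter_morphism (a := a) (b := b) hs 0, ← (describedBy hs hpos).uniform 0] at *
  exact h2.trans (List.length_filter_le _ _)

theorem runLengthsNonneg (hpos : ∀ r ∈ codedBlocks F, 0 < r.1 * (a : ℤ) + r.2.1 * b) :
    F.RunLengthsNonneg a b := by
  refine ⟨fun r hr => ?_, ?_⟩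
  · have := hpos (r.1, r.2.1, r.2.2 + 1) (List.mem_append_left _ (List.mem_map.2 ⟨r, hr, rfl⟩))
    simp only [SymbolicMorphism.runLength] at this ⊢
    omega
  · have := hpos (F.last.1, F.last.2, 0) (List.mem_append_right _ (by simp))
    simp only [SymbolicMorphism.runLength] at this ⊢
    omega

/-- Periodicity moves both positions into the first period. The length c a - e b is kept arbitrary
because item 1 needs a second one, 2 a - 2 b. -/
theorem locateCheck_sound {I : Range} (hI : I.Contains F.s a b) {c e : ℤ} {r l : ℕ}
    {bs : List (ℕ × ℕ)} (hs : staticCheck F = true) (hl : (l : ℤ) = c * a - e * b)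
    (h : I.check F.s (locateCheck F c e r) bs = true) {q q' : ℕ}
    (hC : ∀ t < l, Compatible F.d (codeSequence (gaps F a b) (q + t))
      (codeSequence (gaps F a b) (q' + t)))
    (hne : ∃ t < l, codeSequence (gaps F a b) (q + t) ≠ 1) :
    q ≡ q' [MOD totalLength (gaps F a b)] := by
  obtain ⟨p, q1, p', q1', h, σ, ha, hb⟩ := Range.check_sound hI h
  obtain ⟨G, h, hG, hpos⟩ := withGaps_codedBlocks ha hb h
  obtain ⟨lu, lv, h, -, hrep⟩ := withLin_sound ha hb h
  rw [show (c * a + -e * b : ℤ).toNat = l by rw [neg_mul, ← sub_eq_add_neg, ← hl]; simp] at hrep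
  rw [Bool.and_eq_true] at h
  have hk := (describedBy hs hpos).pos
  have hper : ∀ q t, codeSequence (gaps F a b) (q % totalLength (gaps F a b) + t) =
      codeSequence (gaps F a b) (q + t) := fun q t => by
    rw [← codeSequence_mul_add _ (q / totalLength (gaps F a b)), ← add_assoc, Nat.div_add_mod']
  have hR := reads_codeSequence (gaps_pos hs hpos) 0 2
  simp only [List.replicate_succ, List.replicate_zero, List.flatten_cons, List.flatten_nil,
    List.append_nil, zero_mul] at hR
  refine locate_sound (staticCheck_iff.1 hs).1 hrep hG h.1 h.2 hR (Nat.mod_lt q hk)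
    (Nat.mod_lt q' hk) (fun t ht => ?_) ?_
  · rw [hper, hper]
    exact hC t ht
  · obtain ⟨t, ht, hn⟩ := hne
    exact ⟨t, ht, by rwa [hper]⟩

/-- The walk compares two periods of the sequence with the sequence shifted by m b; s may be reduced
modulo k. -/
theorem shortCheck_sound {I : Range} (hI : I.Contains F.s a b) {m l : ℕ}
    {bs : List (ℕ × ℕ)} (hs : staticCheck F = true) (hl : (l : ℤ) = F.c * a - F.e * b)
    (hab : b < a) (h : I.check F.s (shortCheck F m) bs = true) (hm : m * (a - b) < l) (s : ℕ) :
    ∃ t < m * (a - b), ¬ Compatible F.d (codeSequence (gaps F a b) (s + t))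
      (codeSequence (gaps F a b) (s + t + m * b)) := by
  obtain ⟨p, q1, p', q1', h, σ, ha, hb⟩ := Range.check_sound hI h
  obtain ⟨G, h, hG, hpos⟩ := withGaps_codedBlocks ha hb h
  obtain ⟨Lu, Lv, h, -, hL⟩ := withLin_sound ha hb h
  obtain ⟨ku, kv, h, -, hk⟩ := withLin_sound ha hb h
  obtain ⟨lu, lv, h, -, hrep⟩ := withLin_sound ha hb h
  have hL' : ((m : ℤ) * a + -(m : ℤ) * b).toNat = m * (a - b) := by
    rw [show ((m : ℤ) * a + -(m : ℤ) * b) = ((m * (a - b) : ℕ) : ℤ) by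
      push_cast [hab.le]
      ring, Int.toNat_natCast]
  rw [show (F.c * a + -F.e * b : ℤ).toNat = l by rw [neg_mul, ← sub_eq_add_neg, ← hl]; simp]
    at hrep
  rw [show (F.s * a + -F.t * b : ℤ).toNat = totalLength (gaps F a b) by
    rw [neg_mul, ← sub_eq_add_neg, ← totalLength_gaps hs hpos]; simp] at hk
  rw [hL'] at hL
  simp only [Bool.or_eq_true, Bool.and_eq_true, pairLe_iff] at h
  rcases h with h | ⟨h, hwalk⟩
  · have := hrep.le hL h.1 h.2
    omega
  have hLk := hL.le hk h.1 h.2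
  set k := totalLength (gaps F a b) with hkdef
  have hk0 : 0 < k := (describedBy hs hpos).pos
  have hper : ∀ t, codeSequence (gaps F a b) (s % k + t) =
      codeSequence (gaps F a b) (s + t) := fun t => by
    rw [← codeSequence_mul_add _ (s / k), ← add_assoc, Nat.div_add_mod']
  have hgp := gaps_pos hs hpos
  have hR := reads_codeSequence hgp 0 2
  simp only [List.replicate_succ, List.replicate_zero, List.flatten_cons, List.flatten_nil,
    List.append_nil, zero_mul] at hR
  have hGs : ∀ n, List.Forall₂ (Codes σ) (List.replicate n G).flatten
      (List.replicate n (gaps F a b)).flatten := by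
    intro n
    induction n with
    | zero => exact .nil
    | succ n ih => exact List.rel_append hG ih
  obtain ⟨l', hl1, hl2⟩ := skip_sound (hGs (m + 3)) (hb.smul m)
    (reads_codeSequence hgp 0 (m + 3))
  rw [zero_mul] at hl2
  have hsk := Nat.mod_lt s hk0
  -- The walk starts at P = 0 with c = 0, as if a mismatch immediately preceded.
  obtain ⟨t, ht, hn⟩ := walk_sound (staticCheck_iff.1 hs).1 hL _ _ _ _ _ 0 0 _ _ hwalk
    (Scale.Rep.zero σ) (List.rel_append hG hG) hl1 hR hl2 (s % k) (Nat.zero_le _) (by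
      rw [totalLength_append, ← hkdef]
      omega)
  refine ⟨t, ht, ?_⟩
  rwa [add_assoc, hper, hper, ← add_assoc] at hn

theorem shortChecks_sound {I : Range} {bs : List (ℕ × ℕ)} {M m : ℕ}
    (h : shortChecks F I bs M = true) (hm : 0 < m) (hmM : m ≤ M) :
    I.check F.s (shortCheck F m) bs = true := by
  induction M with
  | zero => omega
  | succ M ih =>
    rw [shortChecks, Bool.and_eq_true] at h
    rcases hmM.lt_or_eq with h1 | rfl
    · exact ih h.2 (by omega)
    · exact h.1

theorem lengthCheck_sound {I : Range} (hI : I.Contains F.s a b) {M : ℕ} (hab : b < a)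
    {bs : List (ℕ × ℕ)} (h : I.check F.s (lengthCheck F M) bs = true) :
    (∀ r ∈ codedBlocks F, 0 < r.1 * (a : ℤ) + r.2.1 * b) ∧
      ∃ l : ℕ, (l : ℤ) = F.c * a - F.e * b ∧ 1 ≤ l ∧ l ≤ M * (a - b) ∧
        ∀ g ∈ gaps F a b, g.1 ≤ l := by
  obtain ⟨p, q1, p', q1', h, σ, ha, hb⟩ := Range.check_sound hI h
  obtain ⟨G, h, hG, hpos⟩ := withGaps_codedBlocks ha hb h
  obtain ⟨lu, lv, h, hl, hrep⟩ := withLin_sound ha hb h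
  obtain ⟨Lu, Lv, h, -, hL⟩ := withLin_sound ha hb h
  rw [show ((M : ℤ) * a + -(M : ℤ) * b).toNat = M * (a - b) by
    rw [show ((M : ℤ) * a + -(M : ℤ) * b) = ((M * (a - b) : ℕ) : ℤ) by
      push_cast [hab.le]
      ring, Int.toNat_natCast]] at hL
  simp only [Bool.and_eq_true, pairLe_iff, Nat.ble_eq, List.all_eq_true] at h
  refine ⟨hpos, _, ?_, ?_, hrep.le hL h.2.1.1 h.2.1.2, fun g hg => ?_⟩
  · rw [Int.toNat_of_nonneg hl]
    ring
  · exact (Scale.Rep.zero σ).lt hrep (Nat.zero_le _) (Nat.zero_le _) (by omega)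
  · obtain ⟨x, hx, hxg⟩ := exists_code hG hg
    exact hxg.1.le hrep (h.2.2 x hx).1 (h.2.2 x hx).2

/-- The gap that contains q ends within l letters, so words of the locating length never consist of
zeros only. -/
theorem exists_ne_one {l : ℕ} (hs : staticCheck F = true)
    (hpos : ∀ r ∈ codedBlocks F, 0 < r.1 * (a : ℤ) + r.2.1 * b)
    (hl : ∀ g ∈ gaps F a b, g.1 ≤ l) (q : ℕ) :
    ∃ t < l, codeSequence (gaps F a b) (q + t) ≠ 1 := by
  set k := totalLength (gaps F a b) with hk
  have hgp := gaps_pos hs hpos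
  have hR := reads_codeSequence hgp (q / k) 1
  rw [List.replicate_one, List.flatten_singleton, ← List.append_nil (gaps F a b)] at hR
  have hlt := Nat.mod_lt q (describedBy hs hpos).pos
  have he := Nat.div_add_mod' q k
  rw [List.append_nil] at hR
  obtain ⟨i, hi, x, hx, hxi, hx', -⟩ := Reads.exists_suffix (gaps F a b) []
    (by rwa [List.append_nil]) (q := q) (by rw [← hk]; omega) (by rw [← hk] at *; omega)
  have h1 := hl _ (List.getElem_mem hi)
  have h2 : 0 < x := hx
  refine ⟨x - 1, by omega, ?_⟩
  rw [hx'.2.2.2.1]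
  exact hx'.2.1

end GapCode

/-! ### Rational ranges, and the conclusion from a complete check. -/

namespace GapCode

variable {a b : ℕ} {F : SymbolicMorphism} {I : Range}

/-- `I` lists the conditions on `a / b` that belong to `F`. -/
structure Range.IsRangeOf (I : Range) (F : SymbolicMorphism) : Prop where
  lo : F.lo = (I.lo.1 : ℚ) / I.lo.2
  incl : F.loIncluded → I.incl = true
  hi : F.hi = (I.hi.1 : ℚ) / I.hi.2
  ex : ∀ e ∈ I.ex, (e.1 : ℚ) / e.2 ∈ F.excluded

theorem Range.IsRangeOf.contains (h : I.IsRangeOf F) (hI : I.wellFormed = true)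
    (hab : F.Admissible a b) : I.Contains F.s a b ∧ b < a ∧ a < 2 * b := by
  simp only [Range.wellFormed, Bool.and_eq_true, Nat.ble_eq] at hI
  obtain ⟨h1, h2, h3, h4⟩ := hI
  obtain ⟨-, hb, hcop, hlo, hhi, hex, hgcd⟩ := hab
  have hb' : (0 : ℚ) < b := by exact_mod_cast hb
  have h1' : (0 : ℚ) < I.lo.2 := by exact_mod_cast h1
  have h2' : (0 : ℚ) < I.hi.2 := by exact_mod_cast h2
  have hlo' : I.lo.1 * b < a * I.lo.2 ∨ I.incl = true ∧ a * I.lo.2 = I.lo.1 * b := by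
    rw [h.lo, div_lt_div_iff₀ h1' hb', div_eq_div_iff h1'.ne' hb'.ne'] at hlo
    rcases hlo with hlo | ⟨hi, hlo⟩
    · exact Or.inl (by exact_mod_cast hlo)
    · exact Or.inr ⟨h.incl hi, by exact_mod_cast hlo.symm⟩
  have hhi' : a * I.hi.2 < I.hi.1 * b := by
    rw [h.hi, div_lt_div_iff₀ hb' h2'] at hhi
    exact_mod_cast hhi
  refine ⟨⟨hb, hcop, hlo', hhi', fun e he he2 heq => hex ?_, hgcd⟩, ?_, ?_⟩
  · have he2' : (0 : ℚ) < e.2 := by exact_mod_cast he2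
    have := h.ex e he
    have heq' : (a : ℚ) * e.2 = e.1 * b := by exact_mod_cast heq
    rwa [(div_eq_div_iff hb'.ne' he2'.ne').2 heq']
  · have h5 : I.lo.1 * b ≤ a * I.lo.2 := by omega
    have h6 : (I.lo.2 + 1) * b ≤ I.lo.1 * b := Nat.mul_le_mul_right b h3
    refine Nat.lt_of_mul_lt_mul_right (a := I.lo.2) ?_
    rw [mul_comm b]
    rw [add_mul] at h6
    omega
  · have h5 : I.hi.1 * b ≤ 2 * I.hi.2 * b := Nat.mul_le_mul_right b h4
    refine Nat.lt_of_mul_lt_mul_right (a := I.hi.2) ?_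
    rw [mul_right_comm]
    omega

/-- Modulo b, k is s a, a product of two numbers coprime to b. -/
theorem coprime_length {k s t : ℕ} (hcop : Nat.Coprime a b) (hs : Nat.gcd b s = 1)
    (hk : (k : ℤ) = s * a - t * b) : Nat.Coprime b k := by
  rw [← Nat.isCoprime_iff_coprime, hk]
  have h1 : IsCoprime (b : ℤ) (s * a) :=
    IsCoprime.mul_right (Nat.isCoprime_iff_coprime.2 hs) (Nat.isCoprime_iff_coprime.2 hcop.symm)
  have h2 := h1.add_mul_left_right (-t)
  rwa [show (s * a + b * -t : ℤ) = s * a - t * b by ring] at h2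

theorem fullCheck_sound {M r : ℕ} {l l' : List (ℕ × ℕ)} (h : fullCheck F I M r l l' = true)
    (hI : I.IsRangeOf F) (a b : ℕ) (hab : F.Admissible a b) :
    F.RunLengthsNonneg a b ∧
      ∃ k l : ℕ, (k : ℤ) = F.s * a - F.t * b ∧ (l : ℤ) = F.c * a - F.e * b ∧
        IsUniformMorphism k (F.morphism a b) ∧
        (∀ n : ℕ, ((F.morphism a b n).filter (fun x => x ≠ 0)).length = F.nonzeroLetters) ∧
        LocatesWordsOfLength k l (F.morphism a b) ∧
        IsPowerFreeMorphism a b (F.morphism a b) := by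
  simp only [fullCheck, Bool.and_eq_true] at h
  obtain ⟨⟨hwf, hs⟩, hlen, hloc, hshort⟩ := h
  obtain ⟨hC, hba, hab2⟩ := hI.contains hwf hab
  obtain ⟨hpos, n, hn, hn1, hnM, hgaps⟩ := lengthCheck_sound hC hba hlen
  have hD := describedBy hs hpos
  have hk := totalLength_gaps hs hpos
  have hloc' : ∀ p p', (∀ t < n, Compatible F.d (codeSequence (gaps F a b) (p + t))
      (codeSequence (gaps F a b) (p' + t))) → p ≡ p' [MOD totalLength (gaps F a b)] :=
    fun p p' hpp => locateCheck_sound hC hs (by exact_mod_cast hn) hloc hpp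
      (exists_ne_one hs hpos hgaps p)
  refine ⟨runLengthsNonneg hpos, totalLength (gaps F a b), n, hk, hn, hD.uniform,
    filter_morphism hs, ⟨two_le_totalLength hs hpos, hn1, hD.uniform,
      fun x hx => hD.locatesWord x hx fun p p' _ => hloc' p p'⟩,
    hD.isPowerFreeMorphism hba hab2 (coprime_length hC.coprime hC.gcd hk)
      (fun m hm hml => shortCheck_sound hC hs hn hba
        (shortChecks_sound hshort hm ?_) hml) hloc'⟩
  -- From m (a - b) < l ≤ M (a - b): only m up to M - 1 have been checked.
  have : m < M := Nat.lt_of_mul_lt_mul_right (hml.trans_le hnM)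
  omega

end GapCode

/-! ### Kernel evaluation of the checks for the thirty morphisms. -/

open GapCode

/-- Here and below, the data after the range are M with l ≤ M (a - b) on the range, the number r of
gaps that enter a key, and the breakpoints for short powers and for locating. They are witnesses to
be verified by the computation. -/
theorem fam_2_2a_b_check :
    fullCheck fam_2_2a_b
      ⟨(5, 3), (2, 1), true, []⟩ 3 0
      []
      [] = true := by
  decide +kernel

theorem fam_3_a_check :
    fullCheck fam_3_a
      ⟨(5, 4), (4, 3), false, []⟩ 3 0
      []
      [(9, 7)] = true := by
  decide +kernel

theorem fam_4_5a_4b_check :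
    fullCheck fam_4_5a_4b
      ⟨(3, 2), (5, 3), false, []⟩ 5 0
      [(8, 5)]
      [] = true := by
  decide +kernel

theorem fam_4_a_check :
    fullCheck fam_4_a
      ⟨(6, 5), (5, 4), false, [(11, 9), (17, 14)]⟩ 6 1
      [(11, 9), (16, 13), (17, 14)]
      [(11, 9), (17, 14)] = true := by
  decide +kernel

theorem fam_6_4a_2b_I_check :
    fullCheck fam_6_4a_2b_I
      ⟨(4, 3), (2, 1), false, [(5, 3), (7, 5)]⟩ 8 2
      [(3, 2), (5, 3), (7, 4), (7, 5), (8, 5), (9, 5), (10, 7), (11, 7), (11, 8), (11, 6),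
       (12, 7), (13, 7), (13, 8), (13, 9), (15, 11)]
      [(3, 2)] = true := by
  decide +kernel

theorem fam_6_4a_2b_II_check :
    fullCheck fam_6_4a_2b_II
      ⟨(4, 3), (2, 1), false, [(5, 3), (7, 5)]⟩ 8 2
      [(3, 2), (5, 3), (7, 4), (7, 5), (8, 5), (9, 5), (10, 7), (11, 7), (11, 8), (11, 6),
       (12, 7), (13, 7), (13, 8), (13, 9), (15, 11)]
      [(3, 2)] = true := by
  decide +kernel

theorem fam_8_5a_3b_check :
    fullCheck fam_8_5a_3b
      ⟨(5, 4), (4, 3), false, [(9, 7)]⟩ 6 1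
      [(9, 7), (13, 10), (14, 11), (17, 13), (19, 15)]
      [(9, 7), (14, 11)] = true := by
  decide +kernel

theorem fam_10_11a_10b_check :
    fullCheck fam_10_11a_10b
      ⟨(6, 5), (5, 4), false, [(11, 9), (16, 13), (17, 14), (23, 19)]⟩ 7 1
      [(11, 9), (16, 13), (17, 14), (21, 17), (23, 19), (28, 23), (26, 21), (27, 22), (29, 24)]
      [] = true := by
  decide +kernel

theorem fam_12_7a_5b_check :
    fullCheck fam_12_7a_5b
      ⟨(7, 6), (6, 5), false, [(13, 11)]⟩ 17 4
      [(13, 11), (19, 16), (20, 17), (25, 21), (27, 23), (31, 26), (32, 27), (33, 28), (34, 29),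
       (37, 31), (41, 35), (43, 36), (44, 37), (45, 38), (46, 39), (48, 41), (47, 40), (49, 41),
       (51, 43)]
      [(13, 11)] = true := by
  decide +kernel

theorem fam_13_7a_4b_check :
    fullCheck fam_13_7a_4b
      ⟨(6, 5), (5, 4), false, []⟩ 5 0
      [(11, 9)]
      [] = true := by
  decide +kernel

theorem fam_14_8a_4b_check :
    fullCheck fam_14_8a_4b
      ⟨(9, 7), (4, 3), true, []⟩ 5 0
      []
      [] = true := by
  decide +kernel

theorem fam_14_6a_b_I_check :
    fullCheck fam_14_6a_b_I
      ⟨(11, 8), (3, 2), false, [(7, 5), (10, 7)]⟩ 20 7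
      [(7, 5), (10, 7), (13, 9), (16, 11), (17, 12), (18, 13), (19, 13), (22, 15), (25, 18),
       (23, 16), (24, 17), (25, 17), (27, 19), (28, 19), (29, 20), (29, 21), (31, 22), (31, 21),
       (32, 23)]
      [(7, 5), (10, 7), (13, 9), (17, 12)] = true := by
  decide +kernel

theorem fam_14_6a_b_II_check :
    fullCheck fam_14_6a_b_II
      ⟨(7, 5), (10, 7), false, []⟩ 7 2
      [(17, 12), (27, 19), (31, 22), (37, 26), (38, 27), (24, 17), (41, 29)]
      [(17, 12), (31, 22), (37, 26), (65, 46)] = true := by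
  decide +kernel

theorem fam_16_9a_7b_check :
    fullCheck fam_16_9a_7b
      ⟨(9, 8), (8, 7), false, []⟩ 7 1
      [(17, 15), (25, 22), (26, 23)]
      [(17, 15)] = true := by
  decide +kernel

theorem fam_18_10a_8b_check :
    fullCheck fam_18_10a_8b
      ⟨(10, 9), (9, 8), false, [(19, 17)]⟩ 15 3
      [(19, 17), (28, 25), (29, 26), (37, 33), (39, 35), (46, 41), (47, 42), (48, 43), (49, 44),
       (59, 53), (55, 49), (64, 57), (65, 58), (66, 59), (67, 60), (68, 61), (69, 62)]
      [(19, 17)] = true := by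
  decide +kernel

theorem fam_20_11a_9b_check :
    fullCheck fam_20_11a_9b
      ⟨(11, 10), (10, 9), false, [(21, 19)]⟩ 14 3
      [(21, 19), (31, 28), (32, 29), (41, 37), (43, 39), (51, 46), (52, 47), (53, 48), (54, 49),
       (61, 55), (65, 59)]
      [(21, 19)] = true := by
  decide +kernel

theorem fam_24_13a_11b_check :
    fullCheck fam_24_13a_11b
      ⟨(13, 12), (12, 11), false, [(25, 23)]⟩ 16 4
      [(25, 23), (37, 34), (38, 35), (49, 45), (51, 47), (61, 56), (62, 57), (63, 58), (64, 59),
       (73, 67), (77, 71), (85, 78), (86, 79)]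
      [(25, 23)] = true := by
  decide +kernel

theorem fam_26_9a_4b_check :
    fullCheck fam_26_9a_4b
      ⟨(7, 6), (6, 5), false, [(13, 11), (20, 17)]⟩ 13 5
      [(13, 11), (20, 17), (19, 16), (25, 21), (27, 23), (31, 26), (32, 27)]
      [(13, 11), (20, 17)] = true := by
  decide +kernel

theorem fam_29_14a_9b_check :
    fullCheck fam_29_14a_9b
      ⟨(8, 7), (6, 5), false, []⟩ 6 0
      [(7, 6), (13, 11), (15, 13), (19, 16)]
      [(7, 6), (13, 11)] = true := by
  decide +kernel

theorem fam_30_10a_5b_check :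
    fullCheck fam_30_10a_5b
      ⟨(15, 13), (22, 19), false, []⟩ 8 1
      [(37, 32)]
      [(37, 32)] = true := by
  decide +kernel

theorem fam_37_24a_15b_check :
    fullCheck fam_37_24a_15b
      ⟨(9, 7), (4, 3), false, []⟩ 9 1
      [(13, 10), (17, 13), (22, 17), (21, 16)]
      [] = true := by
  decide +kernel

theorem fam_38_12a_7b_check :
    fullCheck fam_38_12a_7b
      ⟨(10, 9), (19, 17), false, []⟩ 10 2
      [(29, 26), (39, 35)]
      [(29, 26), (39, 35)] = true := by
  decide +kernel

theorem fam_42_13a_8b_check :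
    fullCheck fam_42_13a_8b
      ⟨(11, 10), (21, 19), false, [(32, 29)]⟩ 11 2
      [(32, 29), (43, 39)]
      [(32, 29), (43, 39)] = true := by
  decide +kernel

theorem fam_46_14a_9b_I_check :
    fullCheck fam_46_14a_9b_I
      ⟨(12, 11), (23, 21), false, []⟩ 10 2
      [(35, 32), (47, 43)]
      [(35, 32), (47, 43)] = true := by
  decide +kernel

theorem fam_46_14a_9b_II_check :
    fullCheck fam_46_14a_9b_II
      ⟨(23, 21), (34, 31), false, []⟩ 12 2
      [(57, 52)]
      [(57, 52)] = true := by
  decide +kernel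

theorem fam_54_13a_5b_check :
    fullCheck fam_54_13a_5b
      ⟨(9, 8), (26, 23), false, [(35, 31)]⟩ 9 1
      [(35, 31)]
      [(35, 31), (53, 47)] = true := by
  decide +kernel

theorem fam_102_38a_15b_check :
    fullCheck fam_102_38a_15b
      ⟨(11, 9), (16, 13), false, []⟩ 11 2
      [(27, 22)]
      [(27, 22)] = true := by
  decide +kernel

theorem fam_158_53a_30b_check :
    fullCheck fam_158_53a_30b
      ⟨(9, 8), (17, 15), false, [(26, 23)]⟩ 16 4
      [(26, 23), (35, 31), (43, 38), (44, 39)]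
      [(26, 23), (35, 31)] = true := by
  decide +kernel

theorem fam_191_66a_28b_check :
    fullCheck fam_191_66a_28b
      ⟨(7, 6), (13, 11), false, [(20, 17)]⟩ 14 3
      [(20, 17), (27, 23), (33, 28), (34, 29)]
      [(20, 17), (27, 23)] = true := by
  decide +kernel

theorem fam_279_67a_30b_check :
    fullCheck fam_279_67a_30b
      ⟨(10, 9), (29, 26), false, [(39, 35)]⟩ 14 3
      [(39, 35), (49, 44)]
      [(39, 35), (59, 53)] = true := by
  decide +kernel

/-! ### Item 1: words of length 2 a - 2 b. -/

theorem fam_2_2a_b_locateCheck :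
    Range.check ⟨(5, 3), (2, 1), true, []⟩ fam_2_2a_b.s (locateCheck fam_2_2a_b 2 2 0) [] =
      true := by
  decide +kernel

theorem fam_2_2a_b_isRangeOf : Range.IsRangeOf ⟨(5, 3), (2, 1), true, []⟩ fam_2_2a_b := by
  constructor <;> norm_num [fam_2_2a_b]

/-- For a = 2 b - 1 one has 2 (a - b) = a - 1, exactly the length of the longer run of zeros, and
the other run is shorter. So a zero word of this length fits in one place only, at the start of an
image. -/
theorem fam_2_2a_b_mod_eq_zero {a b p : ℕ} (hb : b < a) (hab : a = 2 * b - 1)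
    (hp : ∀ t < 2 * (a - b), codeSequence (gaps fam_2_2a_b a b) (p + t) = 1) :
    p % totalLength (gaps fam_2_2a_b a b) = 0 := by
  have hg : gaps fam_2_2a_b a b = [(a, 2), (a - b, 0)] := by
    simp only [gaps, codedBlocks, fam_2_2a_b, gapValue, List.map_cons, List.map_nil,
      List.cons_append, List.nil_append, List.cons.injEq, Prod.mk.injEq, and_true]
    omega
  have hR := reads_codeSequence (l := gaps fam_2_2a_b a b)
    (by rw [hg]; simp; omega) (p / totalLength (gaps fam_2_2a_b a b)) 1
  rw [List.replicate_one, List.flatten_singleton, ← List.append_nil (gaps fam_2_2a_b a b)] at hR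
  have he := Nat.div_add_mod' p (totalLength (gaps fam_2_2a_b a b))
  have hlt := Nat.mod_lt p (y := totalLength (gaps fam_2_2a_b a b)) (by simp [hg]; omega)
  rw [List.append_nil] at hR
  obtain ⟨i, hi, x, hx, hxi, hX, htot⟩ := Reads.exists_suffix (gaps fam_2_2a_b a b) []
    (by rwa [List.append_nil]) (q := p) (by omega) (by omega)
  -- The nonzero letter that ends the current gap must lie beyond the zero word.
  have hxa : 2 * (a - b) < x := by
    by_contra! hle
    exact hX.2.1 (hX.2.2.2.1.symm.trans (hp _ (by dsimp only; omega)))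
  rw [List.append_nil] at hX
  simp only [hg] at hi hxi htot he hlt ⊢
  match i, hi with
  | 0, _ =>
    simp at hxi htot he ⊢
    omega
  | 1, _ =>
    simp at hxi
    omega

theorem fam_2_2a_b_locatesWord {a b : ℕ} (hab : fam_2_2a_b.Admissible a b) (x : List ℕ)
    (hx : x.length = 2 * (a - b)) (h : (∃ y ∈ x, y ≠ 0) ∨ a = 2 * b - 1) :
    LocatesWord (2 * a - b) (fam_2_2a_b.morphism a b) x := by
  have hfull := fam_2_2a_b_check
  simp only [fullCheck, Bool.and_eq_true] at hfull
  obtain ⟨⟨hwf, hs⟩, hlen, -, -⟩ := hfull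
  obtain ⟨hC, hba, hab2⟩ := fam_2_2a_b_isRangeOf.contains hwf hab
  obtain ⟨hpos, -⟩ := lengthCheck_sound hC hba hlen
  have hk : totalLength (gaps fam_2_2a_b a b) = 2 * a - b := by
    have := totalLength_gaps hs hpos
    simp only [fam_2_2a_b] at this ⊢
    omega
  have hl : ((2 * (a - b) : ℕ) : ℤ) = 2 * a - 2 * b := by
    push_cast [hba.le]
    ring
  have hloc := @locateCheck_sound _ _ _ _ hC _ _ _ _ _ hs hl fam_2_2a_b_locateCheck
  rw [← hk]
  refine (describedBy hs hpos).locatesWord x hx fun p p' hdesc hcomp => ?_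
  by_cases hne : ∃ t < 2 * (a - b), codeSequence (gaps fam_2_2a_b a b) (p + t) ≠ 1
  · exact hloc hcomp hne
  by_cases hne' : ∃ t < 2 * (a - b), codeSequence (gaps fam_2_2a_b a b) (p' + t) ≠ 1
  · exact (hloc (fun t ht => Compatible.symm (hcomp t ht)) hne').symm
  push Not at hne hne'
  rcases h with ⟨y, hy, hy0⟩ | h
  -- Code 1 describes only the letter 0, so a word with a nonzero letter cannot occur inside a run
  -- of zeros.
  · obtain ⟨t, ht, rfl⟩ := List.getElem_of_mem hy
    have h1 := hdesc t _ (List.getElem?_eq_getElem ht)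
    rw [hne t (by omega)] at h1
    unfold Describes at h1
    omega
  · rw [Nat.ModEq, fam_2_2a_b_mod_eq_zero hba h hne, fam_2_2a_b_mod_eq_zero hba h hne']

set_option maxRecDepth 4000 in
theorem mainTheorem9 :
    (∀ F ∈ symbolicMorphisms, ∀ a b : ℕ, F.Admissible a b →
      F.RunLengthsNonneg a b ∧
      ∃ k l : ℕ, (k : ℤ) = F.s * a - F.t * b ∧ (l : ℤ) = F.c * a - F.e * b ∧
        IsUniformMorphism k (F.morphism a b) ∧
        (∀ n : ℕ, ((F.morphism a b n).filter (fun x => x ≠ 0)).length = F.nonzeroLetters) ∧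
        LocatesWordsOfLength k l (F.morphism a b) ∧
        IsPowerFreeMorphism a b (F.morphism a b)) ∧
    (∀ a b : ℕ, fam_2_2a_b.Admissible a b →
      ∀ x : List ℕ, x.length = 2 * (a - b) → ((∃ y ∈ x, y ≠ 0) ∨ a = 2 * b - 1) →
        LocatesWord (2 * a - b) (fam_2_2a_b.morphism a b) x) := by
  refine ⟨?_, fun a b => fam_2_2a_b_locatesWord⟩
  simp only [symbolicMorphisms, List.forall_mem_cons, List.not_mem_nil, false_imp_iff, implies_true,
    and_true]
  refine ⟨fullCheck_sound fam_2_2a_b_check ?_,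
    fullCheck_sound fam_3_a_check ?_,
    fullCheck_sound fam_4_5a_4b_check ?_,
    fullCheck_sound fam_4_a_check ?_,
    fullCheck_sound fam_6_4a_2b_I_check ?_,
    fullCheck_sound fam_6_4a_2b_II_check ?_,
    fullCheck_sound fam_8_5a_3b_check ?_,
    fullCheck_sound fam_10_11a_10b_check ?_,
    fullCheck_sound fam_12_7a_5b_check ?_,
    fullCheck_sound fam_13_7a_4b_check ?_,
    fullCheck_sound fam_14_8a_4b_check ?_,
    fullCheck_sound fam_14_6a_b_I_check ?_,
    fullCheck_sound fam_14_6a_b_II_check ?_,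
    fullCheck_sound fam_16_9a_7b_check ?_,
    fullCheck_sound fam_18_10a_8b_check ?_,
    fullCheck_sound fam_20_11a_9b_check ?_,
    fullCheck_sound fam_24_13a_11b_check ?_,
    fullCheck_sound fam_26_9a_4b_check ?_,
    fullCheck_sound fam_29_14a_9b_check ?_,
    fullCheck_sound fam_30_10a_5b_check ?_,
    fullCheck_sound fam_37_24a_15b_check ?_,
    fullCheck_sound fam_38_12a_7b_check ?_,
    fullCheck_sound fam_42_13a_8b_check ?_,
    fullCheck_sound fam_46_14a_9b_I_check ?_,
    fullCheck_sound fam_46_14a_9b_II_check ?_,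
    fullCheck_sound fam_54_13a_5b_check ?_,
    fullCheck_sound fam_102_38a_15b_check ?_,
    fullCheck_sound fam_158_53a_30b_check ?_,
    fullCheck_sound fam_191_66a_28b_check ?_,
    fullCheck_sound fam_279_67a_30b_check ?_⟩
  all_goals
    constructor <;> norm_num [fam_2_2a_b, fam_3_a, fam_4_5a_4b, fam_4_a, fam_6_4a_2b_I,
      fam_6_4a_2b_II, fam_8_5a_3b, fam_10_11a_10b, fam_12_7a_5b, fam_13_7a_4b, fam_14_8a_4b,
      fam_14_6a_b_I, fam_14_6a_b_II, fam_16_9a_7b, fam_18_10a_8b, fam_20_11a_9b, fam_24_13a_11b,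
      fam_26_9a_4b, fam_29_14a_9b, fam_30_10a_5b, fam_37_24a_15b, fam_38_12a_7b, fam_42_13a_8b,
      fam_46_14a_9b_I, fam_46_14a_9b_II, fam_54_13a_5b, fam_102_38a_15b, fam_158_53a_30b,
      fam_191_66a_28b, fam_279_67a_30b]
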